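/- Let $G=(V,E,\ell)$ be a metric graph: $(V,E)$ is a finite connected graph (loops and multiple edges allowed) with at least one edge, each edge $e$ has a length $\ell(e)\in(0,\infty)$, and $G$ is the topological space obtained from the intervals $[0,\ell(e)]$ by gluing endpoints that correspond to the same vertex. Let $H^1(G)$ be the space of continuous functions $f:G\to\mathbb R$ whose restriction to every edge lies in $H^1((0,\ell(e)))$, and put $q(f,g)=\int_G f'g'\,dx$ and $q(f)=q(f,f)$. A function $f\in H^1(G)$ is called harmonic on an open set $O\subset G$ if $q(f,g)=0$ for all $g\in H^1(G)$ vanishing on $G\setminus O$. For a finite Borel measure $\mu$ on $G$ let $H^1(G,\mu)$ be the set of all $f\in H^1(G)$ that are harmonic on $G\setminus\operatorname{supp}\mu$, regarded as a subspace of $L^2(G,\mu)$, and let $H_\mu$ be the self-adjoint operator in $L^2(G,\mu)$ given by: $f\in\operatorname{dom}(H_\mu)$ and $H_\mu f=g$ if and only if $f\in H^1(G,\mu)$ and $q(f,\varphi)=\int_G g\varphi\,d\mu$ for all $\varphi\in H^1(G,\mu)$. Let $\lambda_0(H_\mu)<\lambda_1(H_\mu)\le\dots$ be its eigenvalues, counted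 with multiplicity, with $\lambda_k(H_\mu)=\infty$ if $k\ge\dim L^2(G,\mu)$. Let $\mathcal N$ be the set of Borel probability measures on $G$ and put $$\lambda_1^{\min}(G)=\inf_{\mu\in\mathcal N}\lambda_1(H_\mu).$$ For $x\ne y$ in $G$ write $\mu_{x,y}=\tfrac12\delta_x+\tfrac12\delta_y$. **Theorem.** (i) There are points $x\neq y$ in $G$ with $\lambda_1^{\min}(G)=\lambda_1(H_{\mu_{x,y}})$; in particular, the infimum is a minimum. (ii) Every $\mu\in\mathcal N$ with $\lambda_1(H_\mu)=\lambda_1^{\min}(G)$ is of the form $\mu=\mu_{x,y}$ for some points $x\ne y$ in $G$. (iii) For all $x\neq y$ in $G$ there is a unique $f_{x,y}\in H^1(G)$ that is harmonic on $G\setminus\{x,y\}$ and satisfies $f_{x,y}(x)=1$ and $f_{x,y}(y)=-1$, and $$\lambda_1^{\min}(G)=\min_{x\ne y\in G}\lambda_1(H_{\mu_{x,y}})=\min_{x\neq y\in G}q(f_{x,y}).$$ -/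

import Mathlib

open MeasureTheory
open scoped ENNReal ContDiff

/-- A model `(V, E, ℓ)` of a metric graph: a connected multigraph with vertex set `V` and edge
set `E` (loops and parallel edges are allowed), every edge `e` carrying a chosen orientation from
`src e` to `tgt e` and a length `len e ∈ (0, ∞)`. -/
structure MetricGraph (V E : Type*) where
  src : E → V
  tgt : E → V
  len : E → ℝ
  len_pos : ∀ e, 0 < len e
  connected : ∀ u v : V, Relation.EqvGen (fun a b => ∃ e, src e = a ∧ tgt e = b) u v

noncomputable section

namespace MetricGraph

variable {V E : Type*} (G : MetricGraph V E)

/-- The disjoint union of the vertices and of the intervals `[0, ℓ(e)]`, before glueing. -/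
def PreSpace : Type _ := V ⊕ (Σ e : E, Set.Icc (0 : ℝ) (G.len e))

/-- The disjoint union topology; the vertex set is discrete. -/
instance : TopologicalSpace G.PreSpace :=
  @instTopologicalSpaceSum V (Σ e : E, Set.Icc (0 : ℝ) (G.len e)) ⊥ inferInstance

/-- The initial (terminal) endpoint of each interval is identified with the initial (terminal)
vertex of the edge. -/
inductive Glue : G.PreSpace → G.PreSpace → Prop
  | src (e : E) : Glue (Sum.inr ⟨e, ⟨0, le_rfl, (G.len_pos e).le⟩⟩) (Sum.inl (G.src e))
  | tgt (e : E) : Glue (Sum.inr ⟨e, ⟨G.len e, (G.len_pos e).le, le_rfl⟩⟩) (Sum.inl (G.tgt e))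

/-- The metric graph as a topological space: the quotient of `PreSpace` by the glueing. -/
def Space : Type _ := Quot G.Glue

instance : TopologicalSpace G.Space := inferInstanceAs (TopologicalSpace (Quot G.Glue))

instance : MeasurableSpace G.Space := borel G.Space

instance : BorelSpace G.Space := ⟨rfl⟩

/-- The point at arc length `t ∈ [0, ℓ(e)]` on the edge `e`
(constant for `t ≤ 0` and for `t ≥ ℓ(e)`). -/
def edgePoint (e : E) (t : ℝ) : G.Space :=
  Quot.mk G.Glue (Sum.inr ⟨e, Set.projIcc 0 (G.len e) (G.len_pos e).le t⟩)

/-- `g` is an `L²` weak derivative of `f` on `(0, ℓ)`. -/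
def IsWeakDeriv (ℓ : ℝ) (f g : ℝ → ℝ) : Prop :=
  MemLp g 2 (volume.restrict (Set.Ioo 0 ℓ)) ∧
    ∀ φ : ℝ → ℝ, ContDiff ℝ ∞ φ → HasCompactSupport φ → tsupport φ ⊆ Set.Ioo 0 ℓ →
      ∫ t in Set.Ioo 0 ℓ, f t * deriv φ t = -∫ t in Set.Ioo 0 ℓ, g t * φ t

/-- The Sobolev space `H¹(G)`: continuous functions on `G` whose restriction to every edge has
a weak derivative in `L²`. -/
def H1 : Set (G.Space → ℝ) :=
  {f | Continuous f ∧ ∀ e, ∃ g, IsWeakDeriv (G.len e) (fun t => f (G.edgePoint e t)) g}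

open Classical in
/-- The weak derivative of `f` on the edge `e` (unique almost everywhere for `f ∈ H¹(G)`). -/
def weakDeriv (f : G.Space → ℝ) (e : E) : ℝ → ℝ :=
  if h : ∃ g, IsWeakDeriv (G.len e) (fun t => f (G.edgePoint e t)) g then h.choose else 0

/-- The energy form `q(f, g) = ∫_G f' g' dx`. -/
def energy [Fintype E] (f g : G.Space → ℝ) : ℝ :=
  ∑ e : E, ∫ t in Set.Ioo 0 (G.len e), G.weakDeriv f e t * G.weakDeriv g e t

/-- `f` is harmonic on `O`: `f ∈ H¹(G)` and `q(f, g) = 0` for every `g ∈ H¹(G)` that vanishes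
outside of `O`. -/
def IsHarmonicOn [Fintype E] (f : G.Space → ℝ) (O : Set G.Space) : Prop :=
  f ∈ G.H1 ∧ ∀ g ∈ G.H1, (∀ x ∉ O, g x = 0) → G.energy f g = 0

/-- The form domain `H¹(G, μ)`: functions of `H¹(G)` that are harmonic off the support of `μ`. -/
def H1μ [Fintype E] (μ : Measure G.Space) : Set (G.Space → ℝ) :=
  {f | G.IsHarmonicOn f μ.supportᶜ}

/-- The graph of the Laplacian `H_μ` in `L²(G, μ)`: `LaplacianMaps μ u v` says that
`u ∈ dom(H_μ)` and `H_μ u = v`, i.e. that `u` is the class of some `f ∈ H¹(G, μ)` with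
`q(f, φ) = ∫ v φ dμ` for all `φ ∈ H¹(G, μ)`. -/
def LaplacianMaps [Fintype E] (μ : Measure G.Space) (u v : Lp ℝ 2 μ) : Prop :=
  ∃ f ∈ G.H1μ μ, (u : G.Space → ℝ) =ᵐ[μ] f ∧
    ∀ φ ∈ G.H1μ μ, G.energy f φ = ∫ x, v x * φ x ∂μ

/-- The `k`-th eigenvalue `λ_k(H_μ)`, `k = 0, 1, …`, counted with multiplicity: the least `Λ` for
which there are `k + 1` linearly independent eigenfunctions of `H_μ` in `L²(G, μ)` with
eigenvalues at most `Λ`, and `∞` if there is none. -/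
def eigenvalue [Fintype E] (μ : Measure G.Space) (k : ℕ) : EReal :=
  sInf {Λ : EReal | ∃ (u : Fin (k + 1) → Lp ℝ 2 μ) (t : Fin (k + 1) → ℝ),
    LinearIndependent ℝ u ∧ ∀ i, G.LaplacianMaps μ (u i) (t i • u i) ∧ (t i : EReal) ≤ Λ}

/-- The `k`-th optimal eigenvalue `λ_k^min(G)`: the minimum of `λ_k(H_μ)` over all Borel
probability measures `μ` on `G`. -/
def optimalEigenvalue [Fintype E] (k : ℕ) : EReal :=
  ⨅ (μ : Measure G.Space) (_ : IsProbabilityMeasure μ), G.eigenvalue μ k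

/-- The measure `μ_{x,y} = (δ_x + δ_y) / 2`. -/
def twoPointMeasure (x y : G.Space) : Measure G.Space :=
  (2⁻¹ : ℝ≥0∞) • Measure.dirac x + (2⁻¹ : ℝ≥0∞) • Measure.dirac y

/-- `f` solves the equations that determine `f_{x,y}`:
`f(x) = 1`, `f(y) = -1`, and `f` is harmonic on `G \ {x, y}`. -/
def IsTwoPointSolution [Fintype E] (x y : G.Space) (f : G.Space → ℝ) : Prop :=
  f x = 1 ∧ f y = -1 ∧ G.IsHarmonicOn f {x, y}ᶜ

end MetricGraph

end

/-! Everything is governed by the effective resistance R(x,y), the energy of a Green function w with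
q(w,g) = g(x) − g(y) for all g ∈ H¹(G). It is the best constant in (f(x) − f(y))² ≤ q(f) R(x,y).
Hence √R satisfies the triangle inequality and is continuous; by compactness R attains a maximum r,
and at distinct points.

Lower bound (`IsEigenfunction.four_div_le`): an eigenfunction f of H_μ with eigenvalue t > 0 has
μ-mean zero. With M = max f and m = min f, integrating (M − f)(f − m) ≥ 0 gives ∫f² dμ ≤ −Mm ≤ (M −
m)²/4 ≤ r q(f)/4 = (rt/4) ∫f² dμ, so t ≥ 4/r.

Upper bound (`eigenvalue_twoPointMeasure_le`): f_{x,y} is a rescaled and shifted Green function. It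
has energy 4/R(x,y) and is an eigenfunction for μ_{x,y} with that same eigenvalue. At a pair of
maximal resistance the two bounds meet.

Rigidity: if t = 4/r, every inequality above is an equality, so m = −M and f = ±M almost everywhere.
Each point of either level set is extremal for the resistance bound, and extremality determines the
functional g ↦ q(f,g); since H¹(G) separates points, each level set is one point
(`eq_of_sq_sub_eq_energy`). Mean zero then forces weights 1/2. Because the eigenvalue is defined as
an infimum, a genuine eigenfunction at level 4/r is obtained from the fact that positive eigenvalues
do not accumulate (`finite_eigenvalues`). -/

noncomputable section

namespace MetricGraph

/-! ### Weak derivatives on an interval -/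

section

lemma IsWeakDeriv.congr {ℓ : ℝ} {f₁ f₂ g : ℝ → ℝ} (h : IsWeakDeriv ℓ f₁ g)
    (hf : ∀ t ∈ Set.Ioo 0 ℓ, f₁ t = f₂ t) : IsWeakDeriv ℓ f₂ g := by
  refine ⟨h.1, fun φ h1 h2 h3 => ?_⟩
  rw [← h.2 φ h1 h2 h3]
  exact setIntegral_congr_fun measurableSet_Ioo fun t ht => by simp only [hf t ht]

lemma integrable_mul_test {ℓ : ℝ} {g φ : ℝ → ℝ}
    (hg : IntegrableOn g (Set.Ioo 0 ℓ)) (hφ : Continuous φ) (hc : HasCompactSupport φ) :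
    IntegrableOn (fun t => g t * φ t) (Set.Ioo 0 ℓ) := by
  obtain ⟨C, hC⟩ := hφ.bounded_above_of_compact_support hc
  exact Integrable.mul_bdd (c := C) hg hφ.aestronglyMeasurable (Filter.Eventually.of_forall hC)

lemma integrableOn_of_memLp {ℓ : ℝ} {g : ℝ → ℝ}
    (hg : MemLp g 2 (volume.restrict (Set.Ioo 0 ℓ))) : IntegrableOn g (Set.Ioo 0 ℓ) :=
  hg.integrable (by norm_num)

lemma integrableOn_of_continuous {ℓ : ℝ} {f : ℝ → ℝ} (hf : Continuous f) :
    IntegrableOn f (Set.Ioo 0 ℓ) :=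
  (hf.integrableOn_Icc (a := 0) (b := ℓ)).mono_set Set.Ioo_subset_Icc_self

/-- The difference of two weak derivatives annihilates all test functions. This makes the energy
independent of the choice hidden in `weakDeriv`. -/
lemma IsWeakDeriv.ae_unique {ℓ : ℝ} {f g₁ g₂ : ℝ → ℝ} (h₁ : IsWeakDeriv ℓ f g₁)
    (h₂ : IsWeakDeriv ℓ f g₂) : g₁ =ᵐ[volume.restrict (Set.Ioo 0 ℓ)] g₂ := by
  have i₁ := integrableOn_of_memLp h₁.1
  have i₂ := integrableOn_of_memLp h₂.1
  have := isOpen_Ioo.ae_eq_zero_of_integral_contDiff_smul_eq_zero (U := Set.Ioo (0 : ℝ) ℓ)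
    (f := g₁ - g₂) (μ := volume) (i₁.sub i₂).locallyIntegrableOn
    (fun φ h1 h2 h3 => by
      have hs : ∫ x, φ x • (g₁ - g₂) x = ∫ x in Set.Ioo 0 ℓ, φ x • (g₁ - g₂) x := by
        refine (setIntegral_eq_integral_of_forall_compl_eq_zero fun x hx => ?_).symm
        rw [image_eq_zero_of_notMem_tsupport fun hh => hx (h3 hh), zero_smul]
      rw [hs]
      have e := (h₁.2 φ h1 h2 h3).symm.trans (h₂.2 φ h1 h2 h3)
      have : ∫ x in Set.Ioo 0 ℓ, φ x • (g₁ - g₂) x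
          = (∫ t in Set.Ioo 0 ℓ, g₁ t * φ t) - ∫ t in Set.Ioo 0 ℓ, g₂ t * φ t := by
        rw [← integral_sub (integrable_mul_test i₁ h1.continuous h2)
          (integrable_mul_test i₂ h1.continuous h2)]
        congr 1 with t
        simp only [Pi.sub_apply, smul_eq_mul]; ring
      rw [this]; linarith)
  rw [Filter.EventuallyEq, ae_restrict_iff' measurableSet_Ioo]
  filter_upwards [this] with x hx hx'
  have := hx hx'
  simpa [sub_eq_zero] using this

lemma IsWeakDeriv.add {ℓ : ℝ} {f₁ f₂ g₁ g₂ : ℝ → ℝ} (c₁ : Continuous f₁) (c₂ : Continuous f₂)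
    (h₁ : IsWeakDeriv ℓ f₁ g₁) (h₂ : IsWeakDeriv ℓ f₂ g₂) :
    IsWeakDeriv ℓ (fun t => f₁ t + f₂ t) (fun t => g₁ t + g₂ t) := by
  refine ⟨h₁.1.add h₂.1, fun φ h1 h2 h3 => ?_⟩
  have hd : Continuous (deriv φ) := h1.continuous_deriv (by simp)
  simp only [add_mul]
  rw [integral_add (integrable_mul_test (integrableOn_of_continuous c₁) hd h2.deriv)
    (integrable_mul_test (integrableOn_of_continuous c₂) hd h2.deriv),
    integral_add (integrable_mul_test (integrableOn_of_memLp h₁.1) h1.continuous h2)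
    (integrable_mul_test (integrableOn_of_memLp h₂.1) h1.continuous h2),
    h₁.2 φ h1 h2 h3, h₂.2 φ h1 h2 h3]
  ring

lemma IsWeakDeriv.const_mul {ℓ : ℝ} {f g : ℝ → ℝ} (c : ℝ) (h : IsWeakDeriv ℓ f g) :
    IsWeakDeriv ℓ (fun t => c * f t) (fun t => c * g t) := by
  refine ⟨h.1.const_mul c, fun φ h1 h2 h3 => ?_⟩
  simp only [mul_assoc]
  rw [integral_const_mul, integral_const_mul, h.2 φ h1 h2 h3]
  ring

lemma integral_Ioo_eq_intervalIntegral {ℓ : ℝ} (hℓ : 0 ≤ ℓ) (f : ℝ → ℝ) :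
    ∫ t in Set.Ioo 0 ℓ, f t = ∫ t in (0 : ℝ)..ℓ, f t := by
  rw [intervalIntegral.integral_of_le hℓ, integral_Ioc_eq_integral_Ioo]

/-- Integration by parts of an absolutely continuous function against a test function. -/
lemma integral_mul_deriv_test {ℓ : ℝ} (hℓ : 0 < ℓ) {F φ : ℝ → ℝ}
    (hF : AbsolutelyContinuousOnInterval F 0 ℓ) (hφ : ContDiff ℝ ∞ φ)
    (hs : tsupport φ ⊆ Set.Ioo 0 ℓ) :
    ∫ t in Set.Ioo 0 ℓ, F t * deriv φ t = -∫ t in Set.Ioo 0 ℓ, deriv F t * φ t := by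
  have h0 : φ 0 = 0 := image_eq_zero_of_notMem_tsupport fun h => lt_irrefl _ (hs h).1
  have h1 : φ ℓ = 0 := image_eq_zero_of_notMem_tsupport fun h => lt_irrefl _ (hs h).2
  have hφ' : AbsolutelyContinuousOnInterval φ 0 ℓ :=
    (hφ.of_le (by simp)).contDiffOn.absolutelyContinuousOnInterval
  rw [integral_Ioo_eq_intervalIntegral hℓ.le, integral_Ioo_eq_intervalIntegral hℓ.le,
    hF.integral_mul_deriv_eq_deriv_mul hφ', h0, h1]
  ring

lemma _root_.LipschitzWith.isWeakDeriv {ℓ : ℝ} (hℓ : 0 < ℓ) {F : ℝ → ℝ} {K : NNReal}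
    (hF : LipschitzWith K F) : IsWeakDeriv ℓ F (deriv F) := by
  refine ⟨?_, fun φ h1 _ h3 => integral_mul_deriv_test hℓ
    (hF.lipschitzOnWith.absolutelyContinuousOnInterval) h1 h3⟩
  exact MemLp.of_bound (measurable_deriv F).aestronglyMeasurable K
    (Filter.Eventually.of_forall fun x => norm_deriv_le_of_lipschitz hF)

lemma exists_Icc_of_isCompact_subset_Ioo {ℓ : ℝ} (hℓ : 0 < ℓ) {K : Set ℝ} (hK : IsCompact K)
    (h : K ⊆ Set.Ioo 0 ℓ) : ∃ a b, 0 < a ∧ b < ℓ ∧ K ⊆ Set.Icc a b := by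
  rcases K.eq_empty_or_nonempty with rfl | hne
  · exact ⟨ℓ, 0, hℓ, hℓ, Set.empty_subset _⟩
  · obtain ⟨a, ha⟩ := hK.exists_isLeast hne
    obtain ⟨b, hb⟩ := hK.exists_isGreatest hne
    exact ⟨a, b, (h ha.1).1, (h hb.1).2, fun x hx => ⟨ha.2 hx, hb.2 hx⟩⟩

/-- A test function of integral zero is the derivative of a test function. -/
lemma exists_test_primitive {ℓ : ℝ} (hℓ : 0 < ℓ) {k : ℝ → ℝ} (hk : ContDiff ℝ ∞ k)
    (hc : HasCompactSupport k) (hs : tsupport k ⊆ Set.Ioo 0 ℓ)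
    (h0 : ∫ t in Set.Ioo 0 ℓ, k t = 0) :
    ∃ φ : ℝ → ℝ, ContDiff ℝ ∞ φ ∧ HasCompactSupport φ ∧ tsupport φ ⊆ Set.Ioo 0 ℓ ∧
      deriv φ = k := by
  obtain ⟨a, b, ha, hb, hab⟩ := exists_Icc_of_isCompact_subset_Ioo hℓ hc hs
  have hz : ∀ t, t ∉ Set.Icc a b → k t = 0 := fun t ht =>
    image_eq_zero_of_notMem_tsupport fun h => ht (hab h)
  have hd : deriv (fun t => ∫ s in (0 : ℝ)..t, k s) = k := by
    ext t; exact hk.continuous.deriv_integral _ _ _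
  -- Left of `a` the integrand vanishes; right of `b` the primitive equals the full integral, which
  -- is zero.
  have hsub : tsupport (fun t => ∫ s in (0 : ℝ)..t, k s) ⊆ Set.Icc a b := by
    refine closure_minimal (fun t ht => ?_) isClosed_Icc
    by_contra hn
    apply ht
    rw [Set.mem_Icc, not_and_or, not_le, not_le] at hn
    rcases hn with hn | hn
    · refine intervalIntegral.integral_zero_ae (Filter.Eventually.of_forall fun s hs' => hz s ?_)
      intro h
      rcases Set.mem_uIoc.1 hs' with h' | h' <;> linarith [h.1, h'.1, h'.2]
    · change ∫ s in (0 : ℝ)..t, k s = 0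
      rw [← intervalIntegral.integral_add_adjacent_intervals
        (hk.continuous.intervalIntegrable 0 ℓ) (hk.continuous.intervalIntegrable ℓ t),
        ← integral_Ioo_eq_intervalIntegral hℓ.le, h0, zero_add]
      refine intervalIntegral.integral_zero_ae (Filter.Eventually.of_forall fun s hs' => hz s ?_)
      intro h
      rcases Set.mem_uIoc.1 hs' with h' | h' <;> linarith [h.2, h'.1, h'.2]
  refine ⟨fun t => ∫ s in (0 : ℝ)..t, k s, ?_, isCompact_Icc.of_isClosed_subset
    (isClosed_tsupport _) hsub, hsub.trans fun t ht => ⟨ha.trans_le ht.1, ht.2.trans_lt hb⟩, hd⟩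
  rw [contDiff_infty_iff_deriv, hd]
  exact ⟨fun t => (hk.continuous.integral_hasStrictDerivAt 0 t).hasDerivAt.differentiableAt, hk⟩

/-- The du Bois-Reymond lemma. -/
lemma exists_eq_const_of_integral_mul_deriv {ℓ : ℝ} (hℓ : 0 < ℓ) {h : ℝ → ℝ}
    (hh : ContinuousOn h (Set.Icc 0 ℓ))
    (h0 : ∀ φ : ℝ → ℝ, ContDiff ℝ ∞ φ → HasCompactSupport φ → tsupport φ ⊆ Set.Ioo 0 ℓ →
      ∫ t in Set.Ioo 0 ℓ, h t * deriv φ t = 0) :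
    ∃ c, ∀ t ∈ Set.Icc 0 ℓ, h t = c := by
  -- A fixed test function ρ of integral one; the constant value of `h` will be its average against
  -- ρ.
  let b : ContDiffBump (ℓ / 2) := ⟨ℓ / 8, ℓ / 4, by positivity, by linarith⟩
  let ρ : ℝ → ℝ := b.normed volume
  have ρ1 : ContDiff ℝ ∞ ρ := b.contDiff_normed
  have ρ2 : HasCompactSupport ρ := b.hasCompactSupport_normed
  have ρ3 : tsupport ρ ⊆ Set.Ioo 0 ℓ := by
    rw [b.tsupport_normed_eq, Real.closedBall_eq_Icc]
    intro t ht
    simp only [b, Set.mem_Icc] at ht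
    exact ⟨by linarith [ht.1], by linarith [ht.2]⟩
  have ρ4 : ∫ t in Set.Ioo 0 ℓ, ρ t = 1 := by
    rw [setIntegral_eq_integral_of_forall_compl_eq_zero fun x hx =>
      image_eq_zero_of_notMem_tsupport fun hh => hx (ρ3 hh)]
    exact b.integral_normed
  have ih : IntegrableOn h (Set.Ioo 0 ℓ) :=
    (hh.integrableOn_Icc).mono_set Set.Ioo_subset_Icc_self
  set c := ∫ t in Set.Ioo 0 ℓ, h t * ρ t with hc
  refine ⟨c, ?_⟩
  have key := isOpen_Ioo.ae_eq_zero_of_integral_contDiff_smul_eq_zero (U := Set.Ioo (0 : ℝ) ℓ)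
    (f := fun t => h t - c) (μ := volume)
    (ih.sub (integrableOn_of_continuous continuous_const)).locallyIntegrableOn
    (fun ψ h1 h2 h3 => by
      have hs : ∫ x, ψ x • (h x - c) = ∫ x in Set.Ioo 0 ℓ, ψ x • (h x - c) := by
        refine (setIntegral_eq_integral_of_forall_compl_eq_zero fun x hx => ?_).symm
        rw [image_eq_zero_of_notMem_tsupport fun hh => hx (h3 hh), zero_smul]
      rw [hs]
      set I := ∫ t in Set.Ioo 0 ℓ, ψ t with hI
      have iψ : IntegrableOn ψ (Set.Ioo 0 ℓ) := integrableOn_of_continuous h1.continuous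
      have iρ : IntegrableOn ρ (Set.Ioo 0 ℓ) := integrableOn_of_continuous ρ1.continuous
      have hsk : tsupport (fun t => ψ t - I * ρ t) ⊆ tsupport ψ ∪ tsupport ρ := by
        refine closure_minimal (fun t ht => ?_)
          ((isClosed_tsupport ψ).union (isClosed_tsupport ρ))
        by_contra hn
        rw [Set.mem_union, not_or] at hn
        apply ht
        simp [image_eq_zero_of_notMem_tsupport hn.1, image_eq_zero_of_notMem_tsupport hn.2]
      -- Subtracting `I * ρ` makes the integral zero, so the result is the derivative of an
      -- admissible test function.
      obtain ⟨φ, a1, a2, a3, a4⟩ := exists_test_primitive hℓ (k := fun t => ψ t - I * ρ t)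
        (h1.sub (contDiff_const.mul ρ1))
        ((h2.isCompact.union ρ2.isCompact).of_isClosed_subset (isClosed_tsupport _) hsk)
        (hsk.trans (Set.union_subset h3 ρ3))
        (by rw [integral_sub iψ (iρ.const_mul I), integral_const_mul, ρ4]; simp [hI])
      have := h0 φ a1 a2 a3
      rw [a4] at this
      have i1 := integrable_mul_test ih h1.continuous h2
      have i2 := integrable_mul_test ih ρ1.continuous ρ2
      have e1 : ∫ t in Set.Ioo 0 ℓ, h t * (ψ t - I * ρ t)
          = (∫ t in Set.Ioo 0 ℓ, h t * ψ t) - I * c := by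
        rw [hc, ← integral_const_mul, ← integral_sub i1 (i2.const_mul I)]
        congr 1 with t; ring
      have e2 : ∫ t in Set.Ioo 0 ℓ, ψ t • (h t - c)
          = (∫ t in Set.Ioo 0 ℓ, h t * ψ t) - c * I := by
        rw [hI, ← integral_const_mul, ← integral_sub i1 (iψ.const_mul c)]
        congr 1 with t; simp only [smul_eq_mul]; ring
      rw [e2]; linarith)
  refine Measure.eqOn_Icc_of_ae_eq volume hℓ.ne (f := h) (g := fun _ => c) ?_ hh continuousOn_const
  rw [Filter.EventuallyEq, ← Measure.restrict_congr_set Ioo_ae_eq_Icc,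
    ae_restrict_iff' measurableSet_Ioo]
  filter_upwards [key] with x hx hx'
  exact sub_eq_zero.1 (hx hx')

/-- The fundamental theorem of calculus for weak derivatives. -/
lemma IsWeakDeriv.integral_eq_sub {ℓ : ℝ} (hℓ : 0 < ℓ) {f g : ℝ → ℝ} (hf : Continuous f)
    (h : IsWeakDeriv ℓ f g) {s t : ℝ} (hs : s ∈ Set.Icc 0 ℓ) (ht : t ∈ Set.Icc 0 ℓ) :
    ∫ r in s..t, g r = f t - f s := by
  have ig := integrableOn_of_memLp h.1
  have ig' : IntervalIntegrable g volume 0 ℓ := by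
    rw [intervalIntegrable_iff_integrableOn_Ioo_of_le hℓ.le]; exact ig
  have hac := ig'.absolutelyContinuousOnInterval_intervalIntegral (c := 0) (by simp)
  have hcont : ContinuousOn (fun x => ∫ r in (0 : ℝ)..x, g r) (Set.Icc 0 ℓ) := by
    simpa [Set.uIcc_of_le hℓ.le] using hac.continuousOn
  obtain ⟨c, hc⟩ := exists_eq_const_of_integral_mul_deriv hℓ
    (h := fun x => f x - ∫ r in (0 : ℝ)..x, g r) (hf.continuousOn.sub hcont)
    (fun φ h1 h2 h3 => by
      have hd : Continuous (deriv φ) := h1.continuous_deriv (by simp)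
      simp only [sub_mul]
      rw [integral_sub (integrable_mul_test (integrableOn_of_continuous hf) hd h2.deriv)
        (integrable_mul_test (hcont.integrableOn_Icc.mono_set Set.Ioo_subset_Icc_self) hd h2.deriv),
        h.2 φ h1 h2 h3, integral_mul_deriv_test hℓ hac h1 h3]
      have : ∫ t in Set.Ioo 0 ℓ, deriv (fun x => ∫ r in (0 : ℝ)..x, g r) t * φ t
          = ∫ t in Set.Ioo 0 ℓ, g t * φ t := by
        refine integral_congr_ae ?_
        rw [Filter.EventuallyEq, ae_restrict_iff' measurableSet_Ioo]
        filter_upwards [ig'.ae_hasDerivAt_integral] with x hx hx'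
        rw [(hx (by rw [Set.uIcc_of_le hℓ.le]; exact Set.Ioo_subset_Icc_self hx') 0
          (by simp)).deriv]
      rw [this, sub_self])
  have i : ∀ x ∈ Set.Icc 0 ℓ, IntervalIntegrable g volume 0 x := fun x hx =>
    ig'.mono_set (by
      rw [Set.uIcc_of_le hℓ.le, Set.uIcc_of_le hx.1]; exact Set.Icc_subset_Icc_right hx.2)
  have := intervalIntegral.integral_interval_sub_left (i t ht) (i s hs)
  have h1 := hc s hs
  have h2 := hc t ht
  linarith

/-- The Cauchy–Schwarz inequality for the increment of a function in terms of its derivative. -/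
lemma sq_integral_le {ℓ : ℝ} {g : ℝ → ℝ} (hg : MemLp g 2 (volume.restrict (Set.Ioo 0 ℓ)))
    {s t : ℝ} (hs : 0 ≤ s) (hst : s ≤ t) (ht : t ≤ ℓ) :
    (∫ r in s..t, g r) ^ 2 ≤ (t - s) * ∫ r in Set.Ioo 0 ℓ, g r * g r := by
  have hsub : Set.Ioo s t ⊆ Set.Ioo 0 ℓ := Set.Ioo_subset_Ioo hs ht
  have i1 := integrableOn_of_memLp hg
  have i2 : IntegrableOn (fun r => g r * g r) (Set.Ioo 0 ℓ) := hg.integrable_mul hg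
  have hle : ∫ r in Set.Ioo s t, g r * g r ≤ ∫ r in Set.Ioo 0 ℓ, g r * g r :=
    setIntegral_mono_set i2 (Filter.Eventually.of_forall fun r => mul_self_nonneg _)
      (LE.le.eventuallyLE hsub)
  rw [intervalIntegral.integral_of_le hst, integral_Ioc_eq_integral_Ioo]
  set A := ∫ r in Set.Ioo s t, g r with hA
  have j1 := i1.mono_set hsub
  have j2 := i2.mono_set hsub
  -- Expanding this square gives t − s times the Cauchy–Schwarz defect, with no division by t − s
  -- until the degenerate case is split off.
  have key : 0 ≤ ∫ r in Set.Ioo s t, ((t - s) * g r - A) ^ 2 :=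
    integral_nonneg fun r => sq_nonneg _
  have e : ∫ r in Set.Ioo s t, ((t - s) * g r - A) ^ 2
      = (t - s) ^ 2 * (∫ r in Set.Ioo s t, g r * g r) - 2 * (t - s) * A * A + (t - s) * A ^ 2 := by
    have : ∀ r, ((t - s) * g r - A) ^ 2
      = (t - s) ^ 2 * (g r * g r) - 2 * (t - s) * A * g r + A ^ 2 := fun r => by ring
    simp only [this]
    have k1 := j2.const_mul ((t - s) ^ 2)
    have k2 := j1.const_mul (2 * (t - s) * A)
    have k3 : IntegrableOn (fun r => (t - s) ^ 2 * (g r * g r) - 2 * (t - s) * A * g r)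
      (Set.Ioo s t) := k1.sub k2
    rw [integral_add k3 (integrable_const _), integral_sub k1 k2, integral_const_mul,
      integral_const_mul, ← hA]
    simp [Measure.real, ENNReal.toReal_ofReal (sub_nonneg.2 hst)]
  rcases hst.eq_or_lt with rfl | hlt
  · simp [hA]
  · have hpos : 0 < t - s := sub_pos.2 hlt
    have : 0 ≤ (t - s) * ((t - s) * (∫ r in Set.Ioo s t, g r * g r) - A ^ 2) := by
      calc 0 ≤ _ := key
        _ = _ := by rw [e]; ring
    have := nonneg_of_mul_nonneg_right this hpos
    have := mul_le_mul_of_nonneg_left hle hpos.le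
    linarith

end

/-! ### The glued space, H¹(G) and the energy form -/

section

variable {V E : Type*} (G : MetricGraph V E)

/-- The point of the metric graph that corresponds to a vertex. -/
def vertexPoint (v : V) : G.Space := Quot.mk G.Glue (Sum.inl v)

lemma edgePoint_zero (e : E) : G.edgePoint e 0 = G.vertexPoint (G.src e) := by
  have := Quot.sound (Glue.src (G := G) e)
  rwa [edgePoint, Set.projIcc_left]

lemma edgePoint_len (e : E) : G.edgePoint e (G.len e) = G.vertexPoint (G.tgt e) := by
  have := Quot.sound (Glue.tgt (G := G) e)
  rwa [edgePoint, Set.projIcc_right]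

lemma continuous_edgePoint (e : E) : Continuous (G.edgePoint e) := by
  let _ : TopologicalSpace V := ⊥
  have h1 : Continuous (fun t : ℝ =>
      (Sum.inr ⟨e, Set.projIcc 0 (G.len e) (G.len_pos e).le t⟩ :
        V ⊕ (Σ e : E, Set.Icc (0 : ℝ) (G.len e)))) :=
    continuous_inr.comp (continuous_sigmaMk.comp continuous_projIcc)
  exact (continuous_quot_mk (r := G.Glue)).comp h1

/-- Universal property of the quotient: the vertices are discrete and impose no condition, so only
the edges matter. -/
lemma continuous_iff_edgePoint {X : Type*} [TopologicalSpace X] {f : G.Space → X} :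
    Continuous f ↔ ∀ e, Continuous fun t => f (G.edgePoint e t) := by
  refine ⟨fun h e => h.comp (G.continuous_edgePoint e), fun h => ?_⟩
  let _ : TopologicalSpace V := ⊥
  have _ : DiscreteTopology V := ⟨rfl⟩
  have hq : Topology.IsQuotientMap (Quot.mk G.Glue) := isQuotientMap_quot_mk
  refine hq.continuous_iff.2 ?_
  refine (continuous_sum_dom (X := V) (Y := Σ e : E, Set.Icc (0 : ℝ) (G.len e))).2
    ⟨continuous_of_discreteTopology, continuous_sigma_iff.2 fun e => ?_⟩
  refine ((h e).comp continuous_subtype_val).congr fun t => ?_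
  simp only [Function.comp_apply, edgePoint, Set.projIcc_val]
  rfl

/-- Being an end of some edge is invariant under adjacency, so connectedness and one edge exclude
isolated vertices. Hence edges cover the whole space. -/
lemma exists_edge_of_vertex [Nonempty E] (v : V) : ∃ e, G.src e = v ∨ G.tgt e = v := by
  obtain ⟨e⟩ := ‹Nonempty E›
  have key : ∀ a b, Relation.EqvGen (fun a b => ∃ e, G.src e = a ∧ G.tgt e = b) a b →
      ((∃ e, G.src e = a ∨ G.tgt e = a) ↔ ∃ e, G.src e = b ∨ G.tgt e = b) := by
    intro a b h
    induction h with
    | rel a b h =>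
      obtain ⟨e, he⟩ := h
      exact ⟨fun _ => ⟨e, Or.inr he.2⟩, fun _ => ⟨e, Or.inl he.1⟩⟩
    | refl => rfl
    | symm _ _ _ ih => exact ih.symm
    | trans _ _ _ _ _ ih1 ih2 => exact ih1.trans ih2
  exact (key _ _ (G.connected (G.src e) v)).1 ⟨e, Or.inl rfl⟩

lemma exists_edgePoint_vertex [Nonempty E] (v : V) :
    ∃ e, ∃ t ∈ Set.Icc 0 (G.len e), G.vertexPoint v = G.edgePoint e t := by
  obtain ⟨e, rfl | rfl⟩ := G.exists_edge_of_vertex v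
  · exact ⟨e, 0, ⟨le_rfl, (G.len_pos e).le⟩, (G.edgePoint_zero e).symm⟩
  · exact ⟨e, G.len e, ⟨(G.len_pos e).le, le_rfl⟩, (G.edgePoint_len e).symm⟩

lemma exists_edgePoint [Nonempty E] (x : G.Space) :
    ∃ e, ∃ t ∈ Set.Icc 0 (G.len e), x = G.edgePoint e t := by
  induction x using Quot.ind with
  | mk p =>
    rcases p with v | ⟨e, t⟩
    · exact G.exists_edgePoint_vertex v
    · exact ⟨e, t, t.2, by rw [edgePoint, Set.projIcc_val]⟩

lemma compactSpace [Finite E] [Nonempty E] : CompactSpace G.Space := by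
  refine ⟨?_⟩
  have : (Set.univ : Set G.Space) = ⋃ e, G.edgePoint e '' Set.Icc 0 (G.len e) := by
    ext x
    obtain ⟨e, t, ht, rfl⟩ := G.exists_edgePoint x
    simpa using ⟨e, t, ht, rfl⟩
  rw [this]
  exact isCompact_iUnion fun e => isCompact_Icc.image (G.continuous_edgePoint e)

/-- The function on the metric graph with given values on the vertices and on the edges. -/
def ofEdges (c : V → ℝ) (F : E → ℝ → ℝ) (h0 : ∀ e, F e 0 = c (G.src e))
    (h1 : ∀ e, F e (G.len e) = c (G.tgt e)) : G.Space → ℝ :=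
  Quot.lift (fun p : G.PreSpace =>
    Sum.elim c (fun q : Σ e : E, Set.Icc (0 : ℝ) (G.len e) => F q.1 q.2.1) p) (by
    rintro a b (e | e)
    · exact h0 e
    · exact h1 e)

section ofEdges

variable {c : V → ℝ} {F : E → ℝ → ℝ} {h0 : ∀ e, F e 0 = c (G.src e)}
  {h1 : ∀ e, F e (G.len e) = c (G.tgt e)}

@[simp]
lemma ofEdges_vertexPoint (v : V) : G.ofEdges c F h0 h1 (G.vertexPoint v) = c v := rfl

lemma ofEdges_edgePoint (e : E) (t : ℝ) : G.ofEdges c F h0 h1 (G.edgePoint e t)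
    = F e (Set.projIcc 0 (G.len e) (G.len_pos e).le t) := rfl

lemma ofEdges_edgePoint_of_mem {e : E} {t : ℝ} (ht : t ∈ Set.Icc 0 (G.len e)) :
    G.ofEdges c F h0 h1 (G.edgePoint e t) = F e t := by
  rw [ofEdges_edgePoint, Set.projIcc_of_mem _ ht]

lemma ofEdges_isWeakDeriv {K : E → NNReal} (hF : ∀ e, LipschitzWith (K e) (F e)) (e : E) :
    IsWeakDeriv (G.len e) (fun t => G.ofEdges c F h0 h1 (G.edgePoint e t)) (deriv (F e)) :=
  ((hF e).isWeakDeriv (G.len_pos e)).congr fun _ ht =>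
    (G.ofEdges_edgePoint_of_mem (Set.Ioo_subset_Icc_self ht)).symm

lemma ofEdges_mem_H1 {K : E → NNReal} (hF : ∀ e, LipschitzWith (K e) (F e)) :
    G.ofEdges c F h0 h1 ∈ G.H1 := by
  refine ⟨G.continuous_iff_edgePoint.2 fun e => ?_, fun e => ⟨_, G.ofEdges_isWeakDeriv hF e⟩⟩
  exact (hF e).continuous.comp (continuous_subtype_val.comp
    (continuous_projIcc (h := (G.len_pos e).le)))

end ofEdges

variable {G}

lemma H1.continuous_edge {f : G.Space → ℝ} (hf : f ∈ G.H1) (e : E) :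
    Continuous fun t => f (G.edgePoint e t) := hf.1.comp (G.continuous_edgePoint e)

lemma H1.isWeakDeriv {f : G.Space → ℝ} (hf : f ∈ G.H1) (e : E) :
    IsWeakDeriv (G.len e) (fun t => f (G.edgePoint e t)) (G.weakDeriv f e) := by
  rw [weakDeriv, dif_pos (hf.2 e)]
  exact (hf.2 e).choose_spec

lemma H1.add {f g : G.Space → ℝ} (hf : f ∈ G.H1) (hg : g ∈ G.H1) : f + g ∈ G.H1 :=
  ⟨hf.1.add hg.1, fun e => ⟨_, (H1.isWeakDeriv hf e).add (H1.continuous_edge hf e)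
    (H1.continuous_edge hg e) (H1.isWeakDeriv hg e)⟩⟩

lemma H1.smul {f : G.Space → ℝ} (a : ℝ) (hf : f ∈ G.H1) : a • f ∈ G.H1 :=
  ⟨continuous_const.mul hf.1, fun e => ⟨_, (H1.isWeakDeriv hf e).const_mul a⟩⟩

lemma isWeakDeriv_const (ℓ a : ℝ) : IsWeakDeriv ℓ (fun _ => a) 0 := by
  rcases le_or_gt ℓ 0 with h | h
  · simp [IsWeakDeriv, Set.Ioo_eq_empty_of_le h]
  · simpa [Pi.zero_def] using (LipschitzWith.const a).isWeakDeriv (F := fun _ => a) h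

lemma H1.const (a : ℝ) : (fun _ => a) ∈ G.H1 :=
  ⟨continuous_const, fun _ => ⟨_, isWeakDeriv_const _ a⟩⟩

variable (G) in
/-- The Sobolev space `H¹(G)` as a vector space. -/
def H1Submodule : Submodule ℝ (G.Space → ℝ) where
  carrier := G.H1
  add_mem' := H1.add
  zero_mem' := H1.const 0
  smul_mem' := fun a _ => H1.smul a

lemma integrable_weakDeriv_mul {f g : G.Space → ℝ} (hf : f ∈ G.H1) (hg : g ∈ G.H1) (e : E) :
    IntegrableOn (fun t => G.weakDeriv f e t * G.weakDeriv g e t) (Set.Ioo 0 (G.len e)) :=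
  (H1.isWeakDeriv hf e).1.integrable_mul (H1.isWeakDeriv hg e).1

lemma eq_of_forall_edgePoint_eq [Nonempty E] {f : G.Space → ℝ}
    (h : ∀ e, ∀ s ∈ Set.Icc 0 (G.len e), ∀ t ∈ Set.Icc 0 (G.len e),
      f (G.edgePoint e s) = f (G.edgePoint e t)) (x y : G.Space) : f x = f y := by
  have hv : ∀ u v, f (G.vertexPoint u) = f (G.vertexPoint v) := by
    intro u v
    induction G.connected u v with
    | rel a b hab =>
      obtain ⟨e, rfl, rfl⟩ := hab
      rw [← edgePoint_zero, ← edgePoint_len]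
      exact h e _ ⟨le_rfl, (G.len_pos e).le⟩ _ ⟨(G.len_pos e).le, le_rfl⟩
    | refl => rfl
    | symm _ _ _ ih => exact ih.symm
    | trans _ _ _ _ _ ih1 ih2 => exact ih1.trans ih2
  have hx : ∀ x, ∃ v, f x = f (G.vertexPoint v) := by
    intro x
    obtain ⟨e, t, ht, rfl⟩ := G.exists_edgePoint x
    exact ⟨G.src e, by rw [← edgePoint_zero]; exact h e _ ht _ ⟨le_rfl, (G.len_pos e).le⟩⟩
  obtain ⟨u, hu⟩ := hx x
  obtain ⟨v, hv'⟩ := hx y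
  rw [hu, hv', hv u v]

variable [Fintype E]

/-- Allows the energy to be computed from an explicit derivative of `f`; the chosen derivative of
`g` is left untouched. -/
lemma energy_eq_of_isWeakDeriv {f : G.Space → ℝ} {k : E → ℝ → ℝ}
    (hk : ∀ e, IsWeakDeriv (G.len e) (fun t => f (G.edgePoint e t)) (k e)) (g : G.Space → ℝ) :
    G.energy f g = ∑ e : E, ∫ t in Set.Ioo 0 (G.len e), k e t * G.weakDeriv g e t := by
  refine Finset.sum_congr rfl fun e _ => integral_congr_ae ?_
  have h : IsWeakDeriv (G.len e) (fun t => f (G.edgePoint e t)) (G.weakDeriv f e) := by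
    rw [weakDeriv, dif_pos ⟨_, hk e⟩]; exact Exists.choose_spec (⟨_, hk e⟩ : ∃ g, _)
  filter_upwards [h.ae_unique (hk e)] with t ht
  rw [ht]

lemma energy_comm (f g : G.Space → ℝ) : G.energy f g = G.energy g f := by
  simp only [energy, mul_comm]

lemma energy_add_left {f₁ f₂ g : G.Space → ℝ} (h₁ : f₁ ∈ G.H1) (h₂ : f₂ ∈ G.H1)
    (hg : g ∈ G.H1) : G.energy (f₁ + f₂) g = G.energy f₁ g + G.energy f₂ g := by
  rw [energy_eq_of_isWeakDeriv (k := fun e t => G.weakDeriv f₁ e t + G.weakDeriv f₂ e t)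
    (fun e => (H1.isWeakDeriv h₁ e).add (H1.continuous_edge h₁ e)
      (H1.continuous_edge h₂ e) (H1.isWeakDeriv h₂ e)), energy, energy, ← Finset.sum_add_distrib]
  refine Finset.sum_congr rfl fun e _ => ?_
  rw [← integral_add (integrable_weakDeriv_mul h₁ hg e) (integrable_weakDeriv_mul h₂ hg e)]
  simp only [add_mul]

lemma energy_smul_left {f : G.Space → ℝ} (a : ℝ) (hf : f ∈ G.H1) (g : G.Space → ℝ) :
    G.energy (a • f) g = a * G.energy f g := by
  rw [energy_eq_of_isWeakDeriv (k := fun e t => a * G.weakDeriv f e t)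
    (fun e => (H1.isWeakDeriv hf e).const_mul a), energy, Finset.mul_sum]
  simp only [mul_assoc, integral_const_mul]

lemma energy_const_left (a : ℝ) (g : G.Space → ℝ) : G.energy (fun _ => a) g = 0 := by
  rw [energy_eq_of_isWeakDeriv (k := fun _ => 0) fun e => isWeakDeriv_const _ a]
  simp

variable (G) in
/-- The energy form as a bilinear form on `H¹(G)`. -/
def energyForm : LinearMap.BilinForm ℝ G.H1Submodule :=
  LinearMap.mk₂ ℝ (fun f g => G.energy f.1 g.1)
    (fun f₁ f₂ g => energy_add_left f₁.2 f₂.2 g.2)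
    (fun a f g => energy_smul_left a f.2 g.1)
    (fun f g₁ g₂ => by
      rw [energy_comm f.1 g₁.1, energy_comm f.1 g₂.1, energy_comm]
      exact energy_add_left g₁.2 g₂.2 f.2)
    (fun a f g => by
      rw [energy_comm f.1 g.1, energy_comm]
      exact energy_smul_left a g.2 f.1)

lemma energyForm_apply (f g : G.H1Submodule) : G.energyForm f g = G.energy f.1 g.1 := rfl

lemma energy_self_nonneg (f : G.Space → ℝ) : 0 ≤ G.energy f f :=
  Finset.sum_nonneg fun _ _ => integral_nonneg fun _ => mul_self_nonneg _

/-- Functions of finite energy are Hölder continuous of exponent `1/2`. -/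
lemma sq_sub_le_energy {f : G.Space → ℝ} (hf : f ∈ G.H1) (e : E) {s t : ℝ}
    (hs : s ∈ Set.Icc 0 (G.len e)) (ht : t ∈ Set.Icc 0 (G.len e)) :
    (f (G.edgePoint e t) - f (G.edgePoint e s)) ^ 2 ≤ |t - s| * G.energy f f := by
  wlog hst : s ≤ t generalizing s t
  · have := this ht hs (le_of_not_ge hst)
    rwa [← neg_sub, neg_sq, abs_sub_comm]
  rw [abs_of_nonneg (sub_nonneg.2 hst),
    ← (H1.isWeakDeriv hf e).integral_eq_sub (G.len_pos e) (H1.continuous_edge hf e) hs ht]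
  refine (sq_integral_le (H1.isWeakDeriv hf e).1 hs.1 hst ht.2).trans ?_
  refine mul_le_mul_of_nonneg_left ?_ (sub_nonneg.2 hst)
  exact Finset.single_le_sum
    (f := fun e => ∫ t in Set.Ioo 0 (G.len e), G.weakDeriv f e t * G.weakDeriv f e t)
    (fun _ _ => integral_nonneg fun _ => mul_self_nonneg _) (Finset.mem_univ e)

/-- The Hölder bound makes `f` constant on each edge, and connectedness propagates the constant.
Every uniqueness argument below rests on this. -/
lemma eq_of_energy_eq_zero [Nonempty E] {f : G.Space → ℝ} (hf : f ∈ G.H1)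
    (h : G.energy f f = 0) (x y : G.Space) : f x = f y := by
  refine eq_of_forall_edgePoint_eq (fun e s hs t ht => ?_) x y
  have := sq_sub_le_energy hf e ht hs
  rw [h, mul_zero] at this
  exact sub_eq_zero.1 (pow_eq_zero_iff two_ne_zero |>.1 (le_antisymm this (sq_nonneg _)))

end

/-! ### Explicit test functions and existence of Green functions -/

section

variable {V E : Type*} {G : MetricGraph V E}

lemma edgePoint_projIcc (e : E) (t : ℝ) :
    G.edgePoint e (Set.projIcc 0 (G.len e) (G.len_pos e).le t) = G.edgePoint e t := by
  rw [edgePoint, Set.projIcc_val, edgePoint]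

lemma lipschitzWith_affine (a b : ℝ) : LipschitzWith ‖a‖₊ fun t : ℝ => b + a * t :=
  LipschitzWith.of_dist_le_mul fun x y => by
    rw [Real.dist_eq, Real.dist_eq, coe_nnnorm, Real.norm_eq_abs, ← abs_mul]
    exact le_of_eq (congrArg _ (by ring))

lemma deriv_affine (a b t : ℝ) : deriv (fun t : ℝ => b + a * t) t = a := by
  simp

variable (G) in
/-- The edgewise affine function with given values on the vertices. -/
def affineFun (c : V → ℝ) : G.Space → ℝ :=
  G.ofEdges c (fun e t => c (G.src e) + (c (G.tgt e) - c (G.src e)) / G.len e * t)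
    (fun e => by simp) (fun e => by field_simp [(G.len_pos e).ne']; ring)

lemma affineFun_mem_H1 (c : V → ℝ) : G.affineFun c ∈ G.H1 :=
  G.ofEdges_mem_H1 fun _ => lipschitzWith_affine _ _

variable (G) in
open Classical in
/-- The tent function on the edge `e` with peak at arc length `t`. -/
def tentFun (e : E) (t : ℝ) (ht : t ∈ Set.Icc 0 (G.len e)) : G.Space → ℝ :=
  G.ofEdges 0 (fun e' s => if e' = e then
      min (0 + (1 - t / G.len e) * s) (t + (-(t / G.len e)) * s) else 0)
    (fun e' => by
      split_ifs with h
      · simpa using ht.1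
      · rfl)
    (fun e' => by
      split_ifs with h
      · subst h
        have := (G.len_pos e').ne'
        have h2 := ht.2
        rw [Pi.zero_apply, show 0 + (1 - t / G.len e') * G.len e' = G.len e' - t by field_simp; ring,
          show t + -(t / G.len e') * G.len e' = 0 by field_simp; ring]
        exact min_eq_right (sub_nonneg.2 h2)
      · rfl)

lemma lipschitzWith_tent (p : Prop) [Decidable p] (a b c d : ℝ) :
    LipschitzWith (max ‖a‖₊ ‖c‖₊) fun s : ℝ => if p then min (b + a * s) (d + c * s) else 0 := by
  split_ifs
  · exact (lipschitzWith_affine a b).min (lipschitzWith_affine c d)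
  · exact (LipschitzWith.const 0).weaken (zero_le)

lemma tentFun_mem_H1 {e : E} {t : ℝ} (ht : t ∈ Set.Icc 0 (G.len e)) :
    G.tentFun e t ht ∈ G.H1 :=
  G.ofEdges_mem_H1 fun _ => by classical exact lipschitzWith_tent _ _ _ _ _

/-- A strict maximum at the peak is what separates an interior point of an edge from every other
point. -/
lemma tentFun_lt {e : E} {t : ℝ} (ht : t ∈ Set.Ioo 0 (G.len e)) [Nonempty E] {x : G.Space}
    (hx : x ≠ G.edgePoint e t) :
    G.tentFun e t (Set.Ioo_subset_Icc_self ht) x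
      < G.tentFun e t (Set.Ioo_subset_Icc_self ht) (G.edgePoint e t) := by
  have hl := G.len_pos e
  have h1 : t / G.len e < 1 := (div_lt_one hl).2 ht.2
  have h0 : 0 < t / G.len e := div_pos ht.1 hl
  have e1 : t + -(t / G.len e) * t = (1 - t / G.len e) * t := by ring
  obtain ⟨e', s, hs, rfl⟩ := G.exists_edgePoint x
  rw [tentFun, ofEdges_edgePoint_of_mem _ (Set.Ioo_subset_Icc_self ht),
    ofEdges_edgePoint_of_mem _ hs, if_pos rfl, e1, zero_add (_ * t), min_self]
  split_ifs with h
  · subst h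
    have hst : s ≠ t := fun h => hx (by rw [h])
    rcases lt_or_gt_of_ne hst with h | h
    · refine min_lt_of_left_lt ?_
      rw [zero_add]
      exact mul_lt_mul_of_pos_left h (by linarith)
    · refine min_lt_of_right_lt ?_
      nlinarith
  · exact mul_pos (by linarith) ht.1

/-- Functions in `H¹(G)` separate the points of `G`. -/
lemma exists_H1_ne [Nonempty E] {x y : G.Space} (hxy : x ≠ y) : ∃ g ∈ G.H1, g x ≠ g y := by
  have hc : ∀ x : G.Space, (∃ v, x = G.vertexPoint v) ∨
      ∃ e, ∃ t ∈ Set.Ioo 0 (G.len e), x = G.edgePoint e t := by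
    intro x
    obtain ⟨e, t, ht, rfl⟩ := G.exists_edgePoint x
    rcases ht.1.eq_or_lt with rfl | h0
    · exact Or.inl ⟨_, G.edgePoint_zero e⟩
    rcases ht.2.eq_or_lt with rfl | h1
    · exact Or.inl ⟨_, G.edgePoint_len e⟩
    exact Or.inr ⟨e, t, ⟨h0, h1⟩, rfl⟩
  rcases hc x with ⟨u, rfl⟩ | ⟨e, t, ht, rfl⟩
  · rcases hc y with ⟨v, rfl⟩ | ⟨e, t, ht, rfl⟩
    · classical
      have huv : v ≠ u := fun h => hxy (by rw [h])
      refine ⟨_, affineFun_mem_H1 (Pi.single u 1), ?_⟩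
      simp [affineFun, huv]
    · exact ⟨_, tentFun_mem_H1 _, (tentFun_lt ht hxy).ne⟩
  · exact ⟨_, tentFun_mem_H1 _, (tentFun_lt ht hxy.symm).ne'⟩

lemma integral_weakDeriv {g : G.Space → ℝ} (hg : g ∈ G.H1) (e : E) {s t : ℝ}
    (hs : s ∈ Set.Icc 0 (G.len e)) (ht : t ∈ Set.Icc 0 (G.len e)) :
    ∫ r in s..t, G.weakDeriv g e r = g (G.edgePoint e t) - g (G.edgePoint e s) :=
  (H1.isWeakDeriv hg e).integral_eq_sub (G.len_pos e) (H1.continuous_edge hg e) hs ht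

variable (G) in
lemma exists_ne_points [Nonempty E] : ∃ x y : G.Space, x ≠ y := by
  obtain ⟨e⟩ := ‹Nonempty E›
  have hl := G.len_pos e
  have ht : G.len e / 2 ∈ Set.Icc 0 (G.len e) := ⟨by linarith, by linarith⟩
  refine ⟨G.edgePoint e (G.len e / 2), G.vertexPoint (G.src e), fun h => ?_⟩
  have := congrArg (G.tentFun e _ ht) h
  rw [tentFun, ofEdges_edgePoint_of_mem _ ht, ofEdges_vertexPoint, if_pos rfl] at this
  have e2 : G.len e / 2 / G.len e = 1 / 2 := by field_simp
  rw [e2, min_eq_left (by linarith)] at this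
  simp only [Pi.zero_apply] at this
  linarith

variable [Fintype E]

/-- Against edgewise affine functions, q reduces to the discrete Dirichlet form with conductances
1/ℓ(e), whatever `g` does inside the edges. -/
lemma energy_affineFun {g : G.Space → ℝ} (hg : g ∈ G.H1) (c : V → ℝ) :
    G.energy (G.affineFun c) g = ∑ e : E, (c (G.tgt e) - c (G.src e)) / G.len e *
      (g (G.vertexPoint (G.tgt e)) - g (G.vertexPoint (G.src e))) := by
  rw [affineFun, energy_eq_of_isWeakDeriv
    (G.ofEdges_isWeakDeriv fun _ => lipschitzWith_affine _ _)]
  refine Finset.sum_congr rfl fun e _ => ?_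
  simp only [deriv_affine]
  rw [integral_const_mul, integral_Ioo_eq_intervalIntegral (G.len_pos e).le,
    integral_weakDeriv hg e ⟨le_rfl, (G.len_pos e).le⟩ ⟨(G.len_pos e).le, le_rfl⟩,
    edgePoint_zero, edgePoint_len]

lemma deriv_min_affine_of_lt {a b c d t s : ℝ} (h : b + a * t = d + c * t) (hca : c < a)
    (hs : s < t) : deriv (fun s : ℝ => min (b + a * s) (d + c * s)) s = a := by
  refine (Filter.EventuallyEq.deriv_eq ?_).trans (deriv_affine a b s)
  filter_upwards [Iio_mem_nhds hs] with r hr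
  refine min_eq_left ?_
  nlinarith [Set.mem_Iio.1 hr]

lemma deriv_min_affine_of_gt {a b c d t s : ℝ} (h : b + a * t = d + c * t) (hca : c < a)
    (hs : t < s) : deriv (fun s : ℝ => min (b + a * s) (d + c * s)) s = c := by
  refine (Filter.EventuallyEq.deriv_eq ?_).trans (deriv_affine c d s)
  filter_upwards [Ioi_mem_nhds hs] with r hr
  refine min_eq_right ?_
  nlinarith [Set.mem_Ioi.1 hr]

/-- The slopes are 1 − t/ℓ and −t/ℓ, a drop of one at the peak. The energy therefore compares `g` at
the peak with its linear interpolation from the two ends, which moves a source inside an edge to the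
vertices. -/
lemma energy_tentFun {g : G.Space → ℝ} (hg : g ∈ G.H1) {e : E} {t : ℝ}
    (ht : t ∈ Set.Icc 0 (G.len e)) :
    G.energy (G.tentFun e t ht) g = g (G.edgePoint e t) - g (G.vertexPoint (G.src e)) -
      t / G.len e * (g (G.vertexPoint (G.tgt e)) - g (G.vertexPoint (G.src e))) := by
  classical
  have hl := G.len_pos e
  have hz : (0 : ℝ) ∈ Set.Icc 0 (G.len e) := ⟨le_rfl, hl.le⟩
  have hL : G.len e ∈ Set.Icc 0 (G.len e) := ⟨hl.le, le_rfl⟩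
  rw [tentFun, energy_eq_of_isWeakDeriv
    (G.ofEdges_isWeakDeriv fun _ => lipschitzWith_tent _ _ _ _ _), Finset.sum_eq_single e]
  · simp only [if_true]
    set a := t / G.len e with ha
    have h : 0 + (1 - a) * t = t + -a * t := by ring
    have hca : -a < 1 - a := by linarith
    rw [integral_Ioo_eq_intervalIntegral hl.le]
    have i : IntervalIntegrable (G.weakDeriv g e) volume 0 (G.len e) := by
      rw [intervalIntegrable_iff_integrableOn_Ioo_of_le hl.le]
      exact integrableOn_of_memLp (H1.isWeakDeriv hg e).1
    have i1 : IntervalIntegrable (G.weakDeriv g e) volume 0 t :=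
      i.mono_set (by rw [Set.uIcc_of_le hl.le, Set.uIcc_of_le ht.1]
                     exact Set.Icc_subset_Icc_right ht.2)
    have i2 : IntervalIntegrable (G.weakDeriv g e) volume t (G.len e) :=
      i.mono_set (by rw [Set.uIcc_of_le hl.le, Set.uIcc_of_le ht.2]
                     exact Set.Icc_subset_Icc_left ht.1)
    have c1 : ∀ᵐ r, r ∈ Set.uIoc 0 t → (1 - a) * G.weakDeriv g e r =
        deriv (fun s => min (0 + (1 - a) * s) (t + -a * s)) r * G.weakDeriv g e r := by
      -- The peak itself is discarded as a null set, since the slope changes there.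
      filter_upwards [(Set.finite_singleton t).countable.ae_notMem volume] with r hr hr'
      rw [Set.uIoc_of_le ht.1] at hr'
      rw [deriv_min_affine_of_lt h hca (lt_of_le_of_ne hr'.2 hr)]
    have c2 : ∀ᵐ r, r ∈ Set.uIoc t (G.len e) → -a * G.weakDeriv g e r =
        deriv (fun s => min (0 + (1 - a) * s) (t + -a * s)) r * G.weakDeriv g e r := by
      refine Filter.Eventually.of_forall fun r hr' => ?_
      rw [Set.uIoc_of_le ht.2] at hr'
      rw [deriv_min_affine_of_gt h hca hr'.1]
    have j1 := (i1.const_mul (1 - a)).congr_ae ((ae_restrict_iff' measurableSet_uIoc).2 c1)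
    have j2 := (i2.const_mul (-a)).congr_ae ((ae_restrict_iff' measurableSet_uIoc).2 c2)
    rw [← intervalIntegral.integral_add_adjacent_intervals j1 j2,
      ← intervalIntegral.integral_congr_ae c1, ← intervalIntegral.integral_congr_ae c2,
      intervalIntegral.integral_const_mul, intervalIntegral.integral_const_mul,
      integral_weakDeriv hg e hz ht, integral_weakDeriv hg e ht hL, edgePoint_zero, edgePoint_len]
    ring
  · intro e' _ he'
    simp [he']
  · simp

/-- `w` is a Green function of `G` with source `x` and sink `y`. -/
def IsGreen (x y : G.Space) (w : G.Space → ℝ) : Prop :=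
  w ∈ G.H1 ∧ ∀ g ∈ G.H1, G.energy w g = g x - g y

lemma IsGreen.add {x y z : G.Space} {w w' : G.Space → ℝ} (h : IsGreen x y w)
    (h' : IsGreen y z w') : IsGreen x z (w + w') :=
  ⟨H1.add h.1 h'.1, fun g hg => by
    rw [energy_add_left h.1 h'.1 hg, h.2 g hg, h'.2 g hg]; ring⟩

lemma IsGreen.symm {x y : G.Space} {w : G.Space → ℝ} (h : IsGreen x y w) :
    IsGreen y x ((-1 : ℝ) • w) :=
  ⟨H1.smul _ h.1, fun g hg => by rw [energy_smul_left _ h.1, h.2 g hg]; ring⟩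

/-- Kirchhoff's equations on the finite vertex set. The discrete Dirichlet form is degenerate on
constants; the extra term c(u)d(u) makes it definite, so the system is solvable by
finite-dimensionality. -/
lemma exists_isGreen_vertex [Fintype V] [Nonempty E] (u v : V) :
    ∃ w, IsGreen (G.vertexPoint u) (G.vertexPoint v) w := by
  classical
  let B : (V → ℝ) →ₗ[ℝ] Module.Dual ℝ (V → ℝ) := LinearMap.mk₂ ℝ
    (fun c d => ∑ e : E, (c (G.tgt e) - c (G.src e)) / G.len e * (d (G.tgt e) - d (G.src e))
      + c u * d u)
    (fun c c' d => by
      rw [show ∀ a b a' b' : ℝ, a + b + (a' + b') = (a + a') + (b + b') by intros; ring,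
        ← Finset.sum_add_distrib]
      congr 1
      · exact Finset.sum_congr rfl fun e _ => by simp only [Pi.add_apply]; ring
      · simp only [Pi.add_apply]; ring)
    (fun a c d => by
      rw [smul_eq_mul, mul_add, Finset.mul_sum]
      congr 1
      · exact Finset.sum_congr rfl fun e _ => by simp only [Pi.smul_apply, smul_eq_mul]; ring
      · simp only [Pi.smul_apply, smul_eq_mul]; ring)
    (fun c d d' => by
      rw [show ∀ a b a' b' : ℝ, a + b + (a' + b') = (a + a') + (b + b') by intros; ring,
        ← Finset.sum_add_distrib]
      congr 1
      · exact Finset.sum_congr rfl fun e _ => by simp only [Pi.add_apply]; ring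
      · simp only [Pi.add_apply]; ring)
    (fun a c d => by
      rw [smul_eq_mul, mul_add, Finset.mul_sum]
      congr 1
      · exact Finset.sum_congr rfl fun e _ => by simp only [Pi.smul_apply, smul_eq_mul]; ring
      · simp only [Pi.smul_apply, smul_eq_mul]; ring)
  have hB : ∀ c d, B c d = ∑ e : E, (c (G.tgt e) - c (G.src e)) / G.len e *
      (d (G.tgt e) - d (G.src e)) + c u * d u := fun c d => rfl
  have hinj : Function.Injective B := by
    rw [injective_iff_map_eq_zero]
    intro c hc
    have h0 : B c c = 0 := by rw [hc]; rfl
    have hE : G.energy (G.affineFun c) (G.affineFun c) + c u * c u = 0 := by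
      rw [energy_affineFun (affineFun_mem_H1 c), ← h0, hB]; rfl
    have h1 := energy_self_nonneg (G.affineFun c)
    have h2 := mul_self_nonneg (c u)
    have h3 : c u = 0 := mul_self_eq_zero.1 (by linarith)
    ext w
    rw [Pi.zero_apply, ← h3]
    exact eq_of_energy_eq_zero (affineFun_mem_H1 c) (by linarith)
      (G.vertexPoint w) (G.vertexPoint u)
  have hsurj : Function.Surjective B :=
    (LinearMap.injective_iff_surjective_of_finrank_eq_finrank
      (Subspace.dual_finrank_eq (K := ℝ) (V := V → ℝ)).symm).1 hinj
  obtain ⟨c, hc⟩ := hsurj (LinearMap.proj (R := ℝ) (φ := fun _ : V => ℝ) u - LinearMap.proj v)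
  have hc' : ∀ d : V → ℝ, B c d = d u - d v := fun d => by rw [hc]; rfl
  -- Testing with the constant one shows that the extra term contributes nothing to the solution.
  have hu : c u = 0 := by
    have := hc' (fun _ => 1)
    rw [hB] at this
    simpa using this
  refine ⟨G.affineFun c, affineFun_mem_H1 c, fun g hg => ?_⟩
  rw [energy_affineFun hg, ← hc' fun v => g (G.vertexPoint v), hB, hu, zero_mul, add_zero]

lemma exists_isGreen [Fintype V] [Nonempty E] (x y : G.Space) : ∃ w, IsGreen x y w := by
  have key : ∀ x : G.Space, ∃ v w, IsGreen x (G.vertexPoint v) w := by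
    intro x
    obtain ⟨e, t, ht, rfl⟩ := G.exists_edgePoint x
    obtain ⟨w, hw⟩ := exists_isGreen_vertex (G := G) (G.tgt e) (G.src e)
    -- The tent carries sinks of weight 1 − t/ℓ and t/ℓ at the two ends; the multiple of `w`
    -- transfers the latter to the initial vertex.
    refine ⟨G.src e, G.tentFun e t ht + (t / G.len e) • w,
      H1.add (tentFun_mem_H1 ht) (H1.smul _ hw.1), fun g hg => ?_⟩
    rw [energy_add_left (tentFun_mem_H1 ht) (H1.smul _ hw.1) hg, energy_tentFun hg,
      energy_smul_left _ hw.1, hw.2 g hg]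
    ring
  obtain ⟨u, w, hw⟩ := key x
  obtain ⟨v, w', hw'⟩ := key y
  obtain ⟨w'', h''⟩ := exists_isGreen_vertex (G := G) u v
  exact ⟨_, (hw.add h'').add hw'.symm⟩

/-- The difference of two solutions vanishes at `x` and `y`, so it may be tested against itself and
has zero energy. -/
lemma IsTwoPointSolution.eq [Nonempty E] {x y : G.Space} {f f' : G.Space → ℝ}
    (h : G.IsTwoPointSolution x y f) (h' : G.IsTwoPointSolution x y f') : f = f' := by
  have hm := H1.smul (-1) h'.2.2.1
  have hd : f + (-1 : ℝ) • f' ∈ G.H1 := H1.add h.2.2.1 hm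
  have hdx : (f + (-1 : ℝ) • f') x = 0 := by simp [h.1, h'.1]
  have hdy : (f + (-1 : ℝ) • f') y = 0 := by simp [h.2.1, h'.2.1]
  have hv : ∀ z ∉ ({x, y}ᶜ : Set G.Space), (f + (-1 : ℝ) • f') z = 0 := by
    intro z hz
    simp only [Set.mem_compl_iff, not_not, Set.mem_insert_iff, Set.mem_singleton_iff] at hz
    rcases hz with rfl | rfl
    exacts [hdx, hdy]
  have h0 : G.energy (f + (-1 : ℝ) • f') (f + (-1 : ℝ) • f') = 0 := by
    rw [energy_add_left h.2.2.1 hm hd, energy_smul_left _ h'.2.2.1,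
      h.2.2.2 _ hd hv, h'.2.2.2 _ hd hv]
    ring
  funext z
  have := eq_of_energy_eq_zero hd h0 z x
  rw [hdx] at this
  simp only [Pi.add_apply, Pi.smul_apply, smul_eq_mul] at this
  linarith

end

/-! ### Effective resistance -/

section

variable {V E : Type*} [Fintype V] [Fintype E] [Nonempty E] {G : MetricGraph V E}

/-- A Green function with source `x` and sink `y`. -/
def green (x y : G.Space) : G.Space → ℝ := (exists_isGreen x y).choose

lemma green_mem_H1 (x y : G.Space) : green x y ∈ G.H1 := (exists_isGreen x y).choose_spec.1

lemma energy_green (x y : G.Space) {g : G.Space → ℝ} (hg : g ∈ G.H1) :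
    G.energy (green x y) g = g x - g y := (exists_isGreen x y).choose_spec.2 g hg

/-- The effective resistance between two points. -/
def resistance (x y : G.Space) : ℝ := G.energy (green x y) (green x y)

lemma resistance_eq (x y : G.Space) : resistance x y = green x y x - green x y y :=
  energy_green x y (green_mem_H1 x y)

lemma resistance_nonneg (x y : G.Space) : 0 ≤ resistance x y := energy_self_nonneg _

lemma resistance_pos {x y : G.Space} (h : x ≠ y) : 0 < resistance x y := by
  refine lt_of_le_of_ne (resistance_nonneg x y) fun h0 => ?_
  obtain ⟨g, hg, hne⟩ := exists_H1_ne h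
  apply hne
  have hc := eq_of_energy_eq_zero (green_mem_H1 x y) h0.symm
  have : green x y = fun _ => green x y x := funext fun z => hc z x
  have h1 := energy_green x y hg
  rw [this, energy_const_left] at h1
  linarith

lemma resistance_self (x : G.Space) : resistance x x = 0 := by rw [resistance_eq, sub_self]

lemma energy_add_smul_green {f : G.Space → ℝ} (hf : f ∈ G.H1) (a : ℝ) (x y : G.Space)
    {g : G.Space → ℝ} (hg : g ∈ G.H1) :
    G.energy (f + a • green x y) g = G.energy f g + a * (g x - g y) := by
  rw [energy_add_left hf (H1.smul a (green_mem_H1 x y)) hg,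
    energy_smul_left a (green_mem_H1 x y), energy_green x y hg]

lemma energy_self_add_smul_green {f : G.Space → ℝ} (hf : f ∈ G.H1) (a : ℝ) (x y : G.Space) :
    G.energy (f + a • green x y) (f + a • green x y)
      = G.energy f f + 2 * a * (f x - f y) + a ^ 2 * resistance x y := by
  have hw := green_mem_H1 x y
  rw [energy_add_smul_green hf a x y (H1.add hf (H1.smul a hw)), energy_comm f,
    energy_add_smul_green hf a x y hf, resistance_eq]
  simp only [Pi.add_apply, Pi.smul_apply, smul_eq_mul]
  ring

/-- The resistance bounds the oscillation of functions of finite energy. -/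
lemma sq_sub_le_energy_mul_resistance {f : G.Space → ℝ} (hf : f ∈ G.H1) (x y : G.Space) :
    (f x - f y) ^ 2 ≤ G.energy f f * resistance x y := by
  rcases eq_or_ne x y with rfl | hxy
  · simp [resistance_self]
  have hR := resistance_pos hxy
  -- This coefficient minimises the energy, a quadratic polynomial in the multiple of the Green
  -- function.
  have h := energy_self_nonneg (f + (-((f x - f y) / resistance x y)) • green x y)
  rw [energy_self_add_smul_green hf] at h
  have h2 := mul_nonneg h hR.le
  have : (G.energy f f + 2 * -((f x - f y) / resistance x y) * (f x - f y) +
      (-((f x - f y) / resistance x y)) ^ 2 * resistance x y) * resistance x y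
      = G.energy f f * resistance x y - (f x - f y) ^ 2 := by
    field_simp; ring
  linarith

/-- The Green function attains equality in the resistance bound, so R is the smallest possible
constant. Estimates of R thus reduce to estimates of oscillation. -/
lemma resistance_le {x y : G.Space} {C : ℝ} (hC : 0 ≤ C)
    (h : ∀ f ∈ G.H1, (f x - f y) ^ 2 ≤ C * G.energy f f) : resistance x y ≤ C := by
  have h1 := h _ (green_mem_H1 x y)
  rw [← resistance_eq] at h1
  change _ ≤ C * resistance x y at h1
  rcases (resistance_nonneg x y).eq_or_lt with h0 | h0
  · exact h0 ▸ hC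
  · exact le_of_mul_le_mul_right (by linarith [sq (resistance x y)]) h0

lemma abs_sub_le_sqrt_resistance {f : G.Space → ℝ} (hf : f ∈ G.H1) (x y : G.Space) :
    |f x - f y| ≤ √(resistance x y) * √(G.energy f f) := by
  rw [← Real.sqrt_mul (resistance_nonneg x y), mul_comm]
  exact Real.abs_le_sqrt (sq_sub_le_energy_mul_resistance hf x y)

lemma resistance_comm (x y : G.Space) : resistance x y = resistance y x := by
  have key : ∀ x y : G.Space, resistance x y ≤ resistance y x := fun x y =>
    resistance_le (resistance_nonneg y x) fun f hf => by
      have := sq_sub_le_energy_mul_resistance hf y x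
      nlinarith
  exact le_antisymm (key x y) (key y x)

/-- √R(x,z) is the norm of f ↦ f(x) − f(z) with respect to the energy seminorm, and these
functionals add along y. -/
lemma sqrt_resistance_triangle (x y z : G.Space) :
    √(resistance x z) ≤ √(resistance x y) + √(resistance y z) := by
  rw [Real.sqrt_le_left (by positivity)]
  refine resistance_le (by positivity) fun f hf => ?_
  have h1 := abs_sub_le_sqrt_resistance hf x y
  have h2 := abs_sub_le_sqrt_resistance hf y z
  have h3 := abs_sub_le (f x) (f y) (f z)
  rw [← Real.sq_sqrt (energy_self_nonneg f), ← mul_pow, ← sq_abs]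
  gcongr
  linarith

lemma resistance_edgePoint_le (e : E) {s t : ℝ} (hs : s ∈ Set.Icc 0 (G.len e))
    (ht : t ∈ Set.Icc 0 (G.len e)) :
    resistance (G.edgePoint e t) (G.edgePoint e s) ≤ |t - s| :=
  resistance_le (abs_nonneg _) fun _ hf => sq_sub_le_energy hf e hs ht

lemma abs_sqrt_resistance_sub_le (x y x' y' : G.Space) :
    |√(resistance x y) - √(resistance x' y')| ≤ √(resistance x x') + √(resistance y y') := by
  have h1 := sqrt_resistance_triangle x x' y
  have h2 := sqrt_resistance_triangle x' y' y
  have h3 := sqrt_resistance_triangle x' x y'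
  have h4 := sqrt_resistance_triangle x y y'
  rw [resistance_comm x' x] at h3
  rw [resistance_comm y' y] at h2
  rw [abs_le]
  constructor <;> linarith

lemma continuous_sqrt_resistance_left (y : G.Space) :
    Continuous fun x : G.Space => √(resistance x y) := by
  refine G.continuous_iff_edgePoint.2 fun e => continuous_iff_continuousAt.2 fun t => ?_
  -- `edgePoint` clamps its parameter, so the bound is stated with projected parameters to hold for
  -- every real `s`.
  have hb : ∀ s, |√(resistance (G.edgePoint e s) y) - √(resistance (G.edgePoint e t) y)| ≤
      √|(Set.projIcc 0 (G.len e) (G.len_pos e).le s : ℝ)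
        - Set.projIcc 0 (G.len e) (G.len_pos e).le t| := by
    intro s
    refine (abs_sqrt_resistance_sub_le _ _ _ _).trans ?_
    rw [resistance_self, Real.sqrt_zero, add_zero, ← edgePoint_projIcc e s, ← edgePoint_projIcc e t]
    exact Real.sqrt_le_sqrt (resistance_edgePoint_le e (Subtype.coe_prop _) (Subtype.coe_prop _))
  rw [ContinuousAt, tendsto_iff_dist_tendsto_zero]
  have hc : Continuous fun s => √|(Set.projIcc 0 (G.len e) (G.len_pos e).le s : ℝ)
        - Set.projIcc 0 (G.len e) (G.len_pos e).le t| :=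
    (((continuous_subtype_val.comp (continuous_projIcc (h := (G.len_pos e).le))).sub
      continuous_const).abs).sqrt
  exact squeeze_zero (fun _ => dist_nonneg) hb (by simpa using hc.tendsto t)

lemma continuous_sqrt_resistance :
    Continuous fun p : G.Space × G.Space => √(resistance p.1 p.2) := by
  refine continuous_iff_continuousAt.2 fun p => ?_
  rw [ContinuousAt, tendsto_iff_dist_tendsto_zero]
  have hc : Continuous fun q : G.Space × G.Space =>
      √(resistance q.1 p.1) + √(resistance q.2 p.2) :=
    ((continuous_sqrt_resistance_left p.1).comp continuous_fst).add
      ((continuous_sqrt_resistance_left p.2).comp continuous_snd)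
  exact squeeze_zero (fun _ => dist_nonneg) (fun q => abs_sqrt_resistance_sub_le _ _ _ _)
    (by simpa [resistance_self] using hc.tendsto p)

variable (G) in
/-- The effective resistance attains its maximum. -/
lemma exists_max_resistance :
    ∃ x y : G.Space, x ≠ y ∧ ∀ x' y' : G.Space, resistance x' y' ≤ resistance x y := by
  obtain ⟨a, b, hab⟩ := G.exists_ne_points
  have := G.compactSpace
  obtain ⟨p, -, hp⟩ := isCompact_univ.exists_isMaxOn (s := (Set.univ : Set (G.Space × G.Space)))
    ⟨(a, b), trivial⟩ continuous_sqrt_resistance.continuousOn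
  have hmax : ∀ x' y' : G.Space, resistance x' y' ≤ resistance p.1 p.2 := fun x' y' =>
    (Real.sqrt_le_sqrt_iff (resistance_nonneg _ _)).1 (hp (Set.mem_univ (x', y')))
  refine ⟨p.1, p.2, fun h => ?_, hmax⟩
  have h1 := hmax a b
  rw [h, resistance_self] at h1
  exact absurd (resistance_pos hab) (not_lt.2 h1)

/-- If `f` attains equality in the resistance bound at `(x, y)`, it is a multiple of the Green
function up to a constant. -/
lemma energy_eq_of_sq_sub_eq {f : G.Space → ℝ} (hf : f ∈ G.H1) {x y : G.Space} (hxy : x ≠ y)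
    (h : (f x - f y) ^ 2 = G.energy f f * resistance x y) {g : G.Space → ℝ} (hg : g ∈ G.H1) :
    G.energy f g = (f x - f y) / resistance x y * (g x - g y) := by
  have hR := resistance_pos hxy
  set a := -((f x - f y) / resistance x y) with ha
  have hfa : f + a • green x y ∈ G.H1 := H1.add hf (H1.smul a (green_mem_H1 x y))
  -- Equality means that the minimum of the quadratic polynomial in the coefficient is zero.
  have h0 : G.energy (f + a • green x y) (f + a • green x y) = 0 := by
    rw [energy_self_add_smul_green hf]
    have : (G.energy f f + 2 * a * (f x - f y) + a ^ 2 * resistance x y) * resistance x y = 0 := by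
      have e1 : a * resistance x y = -(f x - f y) := by rw [ha]; field_simp
      calc _ = G.energy f f * resistance x y + 2 * (a * resistance x y) * (f x - f y)
              + (a * resistance x y) ^ 2 := by ring
        _ = 0 := by rw [e1, ← h]; ring
    exact (mul_eq_zero.1 this).resolve_right hR.ne'
  have hc : f + a • green x y = fun _ => (f + a • green x y) x :=
    funext fun z => eq_of_energy_eq_zero hfa h0 z x
  have h1 := energy_add_smul_green hf a x y hg
  rw [hc, energy_const_left] at h1
  rw [ha] at h1
  linarith

/-- The Green function drops by R from x to y, so the factor 2/R and a shift produce the values 1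
and −1. The formula for q(f,g) gives harmonicity and the energy at once. -/
lemma exists_isTwoPointSolution {x y : G.Space} (hxy : x ≠ y) :
    ∃ f, G.IsTwoPointSolution x y f ∧ G.energy f f = 4 / resistance x y ∧
      ∀ g ∈ G.H1, G.energy f g = 2 / resistance x y * (g x - g y) := by
  have hR := resistance_pos hxy
  set a := 2 / resistance x y with ha
  have hw := green_mem_H1 x y
  set f : G.Space → ℝ := (fun _ => 1 - a * green x y x) + a • green x y with hf
  have hmem : f ∈ G.H1 :=
    H1.add (H1.const _) (H1.smul _ hw)
  have hE : ∀ g ∈ G.H1, G.energy f g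
      = a * (g x - g y) := fun g hg => by
    rw [hf, energy_add_smul_green (H1.const _) a x y hg, energy_const_left, zero_add]
  have hx : f x = 1 := by simp [hf]
  have hy : f y = -1 := by
    have : a * (green x y x - green x y y) = 2 := by
      rw [← resistance_eq, ha]; field_simp
    simp only [hf, Pi.add_apply, Pi.smul_apply, smul_eq_mul]
    linarith
  refine ⟨f, ⟨hx, hy, hmem, fun g hg h0 => ?_⟩, ?_, hE⟩
  · rw [hE g hg, h0 x (by simp), h0 y (by simp)]; ring
  · rw [hE _ hmem, hx, hy, ha]; ring

end

/-! ### Eigenfunctions and rigidity of two-point measures -/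

section

variable {V E : Type*} [Fintype E] [Nonempty E] {G : MetricGraph V E}

lemma exists_bound_of_continuous {f : G.Space → ℝ} (hf : Continuous f) : ∃ C, ∀ x, ‖f x‖ ≤ C := by
  have := G.compactSpace
  obtain ⟨C, hC⟩ := isCompact_univ.exists_bound_of_continuousOn hf.continuousOn
  exact ⟨C, fun x => hC x trivial⟩

lemma memLp_of_continuous {f : G.Space → ℝ} (hf : Continuous f) (μ : Measure G.Space)
    [IsFiniteMeasure μ] (p : ℝ≥0∞) : MemLp f p μ := by
  obtain ⟨C, hC⟩ := exists_bound_of_continuous hf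
  exact MemLp.of_bound hf.aestronglyMeasurable C (Filter.Eventually.of_forall hC)

lemma integrable_of_continuous {f : G.Space → ℝ} (hf : Continuous f) (μ : Measure G.Space)
    [IsFiniteMeasure μ] : Integrable f μ :=
  (memLp_of_continuous hf μ 1).integrable le_rfl

omit [Nonempty E] in
lemma const_mem_H1μ (a : ℝ) (μ : Measure G.Space) : (fun _ => a) ∈ G.H1μ μ :=
  ⟨H1.const a, fun _ _ _ => energy_const_left a _⟩

/-- `f` represents an eigenfunction of `H_μ` with eigenvalue `t`. -/
def IsEigenfunction (μ : Measure G.Space) (t : ℝ) (f : G.Space → ℝ) : Prop :=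
  f ∈ G.H1μ μ ∧ (∀ φ ∈ G.H1μ μ, G.energy f φ = t * ∫ x, f x * φ x ∂μ) ∧ 0 < ∫ x, f x * f x ∂μ

/-- Replaces an L² class by its continuous representative, for which pointwise values, maxima and
minima make sense. -/
lemma LaplacianMaps.exists_isEigenfunction {μ : Measure G.Space} [IsFiniteMeasure μ]
    {u : Lp ℝ 2 μ} {t : ℝ} (hu : u ≠ 0) (h : G.LaplacianMaps μ u (t • u)) :
    ∃ f, IsEigenfunction μ t f ∧ (u : G.Space → ℝ) =ᵐ[μ] f := by
  obtain ⟨f, hf, huf, hφ⟩ := h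
  refine ⟨f, ⟨hf, fun φ hφ' => ?_, ?_⟩, huf⟩
  · rw [hφ φ hφ', ← integral_const_mul]
    refine integral_congr_ae ?_
    filter_upwards [Lp.coeFn_smul t u, huf] with x h1 h2
    rw [h1, Pi.smul_apply, h2, smul_eq_mul, mul_assoc]
  · have hnn : 0 ≤ fun x => f x * f x := fun x => mul_self_nonneg _
    refine lt_of_le_of_ne (integral_nonneg hnn) fun h0 => hu ?_
    have hi : Integrable (fun x => f x * f x) μ :=
      integrable_of_continuous (hf.1.1.mul hf.1.1) μ
    have hz := (integral_eq_zero_iff_of_nonneg hnn hi).1 h0.symm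
    refine (Lp.eq_zero_iff_ae_eq_zero).2 ?_
    filter_upwards [huf, hz] with x h1 h2
    rw [h1]
    exact mul_self_eq_zero.1 h2

section

variable {μ : Measure G.Space} {t : ℝ} {f : G.Space → ℝ}

omit [Nonempty E] in
lemma IsEigenfunction.energy_self (h : IsEigenfunction μ t f) :
    G.energy f f = t * ∫ x, f x * f x ∂μ := h.2.1 f h.1

omit [Nonempty E] in
lemma IsEigenfunction.nonneg (h : IsEigenfunction μ t f) : 0 ≤ t :=
  nonneg_of_mul_nonneg_left (h.energy_self ▸ energy_self_nonneg f) h.2.2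

omit [Nonempty E] in
lemma IsEigenfunction.integral_eq_zero (h : IsEigenfunction μ t f) (ht : t ≠ 0) :
    ∫ x, f x ∂μ = 0 := by
  have := h.2.1 _ (const_mem_H1μ 1 μ)
  rw [energy_comm, energy_const_left] at this
  simpa [ht] using this

omit [Nonempty E] in
lemma IsEigenfunction.integral_mul_eq_zero {s : ℝ} {g : G.Space → ℝ} (h : IsEigenfunction μ t f)
    (h' : IsEigenfunction μ s g) (hts : t ≠ s) : ∫ x, f x * g x ∂μ = 0 := by
  have h1 := h.2.1 g h'.1
  have h2 := h'.2.1 f h.1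
  rw [energy_comm, h1] at h2
  simp only [mul_comm (g _)] at h2
  by_contra hne
  exact hts (mul_right_cancel₀ hne h2)

end

/-- Among two independent eigenfunctions there is one with a positive eigenvalue. -/
lemma exists_pos_isEigenfunction {μ : Measure G.Space} [IsFiniteMeasure μ]
    {u : Fin 2 → Lp ℝ 2 μ} {t : Fin 2 → ℝ} (hu : LinearIndependent ℝ u)
    (h : ∀ i, G.LaplacianMaps μ (u i) (t i • u i)) : ∃ i f, 0 < t i ∧ IsEigenfunction μ (t i) f := by
  choose f hf huf using fun i => (h i).exists_isEigenfunction (hu.ne_zero i)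
  by_contra hcon
  push Not at hcon
  -- Eigenvalue zero forces zero energy, hence a nonzero constant; two constants are linearly
  -- dependent.
  have hc : ∀ i, ∃ c, c ≠ 0 ∧ f i = fun _ => c := by
    intro i
    have ht : t i = 0 :=
      le_antisymm (not_lt.1 fun h0 => hcon i (f i) h0 (hf i)) (hf i).nonneg
    have hE : G.energy (f i) (f i) = 0 := by rw [(hf i).energy_self, ht, zero_mul]
    obtain ⟨x, -⟩ := G.exists_ne_points
    have hfi : f i = fun _ => f i x := funext fun z => eq_of_energy_eq_zero (hf i).1.1 hE z x
    refine ⟨f i x, fun h0 => ?_, hfi⟩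
    have := (hf i).2.2
    rw [hfi, h0] at this
    simp at this
  obtain ⟨a, ha, hfa⟩ := hc 0
  obtain ⟨b, hb, hfb⟩ := hc 1
  refine hb (Fintype.linearIndependent_iff.1 hu ![b, -a] ?_ 0)
  rw [Fin.sum_univ_two, Lp.eq_zero_iff_ae_eq_zero]
  filter_upwards [Lp.coeFn_add (b • u 0) (-a • u 1), Lp.coeFn_smul b (u 0),
    Lp.coeFn_smul (-a) (u 1), huf 0, huf 1] with x h1 h2 h3 h4 h5
  simp only [Matrix.cons_val_zero, Matrix.cons_val_one]
  rw [h1, Pi.add_apply, h2, h3, Pi.smul_apply, Pi.smul_apply, h4, h5, hfa, hfb]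
  simp only [smul_eq_mul, Pi.zero_apply]
  ring

/-- Distinct points cannot both realize the extremal difference of `f`. -/
lemma eq_of_sq_sub_eq_energy [Fintype V] {f : G.Space → ℝ} (hf : f ∈ G.H1) {r : ℝ}
    (hr : ∀ x y : G.Space, resistance x y ≤ r) (hq : 0 < G.energy f f) {x y z : G.Space}
    (hxy : f x ≠ f y) (h : (f x - f y) ^ 2 = G.energy f f * r) (hz : f z = f x) : z = x := by
  -- The bound at (w, y) has the same left side, so the resistance there must also be maximal.
  have hR : ∀ w, f w = f x → resistance w y = r := fun w hw => by
    have h1 := sq_sub_le_energy_mul_resistance hf w y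
    rw [hw, h] at h1
    exact le_antisymm (hr w y) (le_of_mul_le_mul_left h1 hq)
  have hE : ∀ w, f w = f x → ∀ g ∈ G.H1, G.energy f g = (f x - f y) / r * (g w - g y) :=
    fun w hw g hg => by
      have := energy_eq_of_sq_sub_eq hf (x := w) (y := y) (fun h' => hxy (by rw [← hw, h']))
        (by rw [hw, h, hR w hw]) hg
      rwa [hw, hR w hw] at this
  have hr0 : r ≠ 0 := by
    rintro rfl
    rw [mul_zero, sq_eq_zero_iff, sub_eq_zero] at h
    exact hxy h
  by_contra hne
  obtain ⟨g, hg, hgne⟩ := exists_H1_ne hne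
  have h1 := (hE z hz g hg).symm.trans (hE x rfl g hg)
  have h2 := mul_left_cancel₀ (div_ne_zero (sub_ne_zero.2 hxy) hr0) h1
  exact hgne (by linarith)

omit [Fintype E] [Nonempty E] in
/-- A probability measure for which a function of mean zero is a.e. `M` or `-M`, each value being
attained at one point only, is a two-point measure. -/
lemma eq_twoPointMeasure {μ : Measure G.Space} [IsProbabilityMeasure μ] {f : G.Space → ℝ}
    (hf : Continuous f) {M : ℝ} (hM : M ≠ 0) {x y : G.Space}
    (hx : ∀ z, f z = M ↔ z = x) (hy : ∀ z, f z = -M ↔ z = y)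
    (hae : ∀ᵐ z ∂μ, f z = M ∨ f z = -M) (h0 : ∫ z, f z ∂μ = 0) :
    μ = G.twoPointMeasure x y := by
  have key : ∀ (M : ℝ) (x y : G.Space), M ≠ 0 → (∀ z, f z = M ↔ z = x) →
      (∀ᵐ z ∂μ, f z = M ∨ f z = -M) → μ {x} = 2⁻¹ := by
    intro M x y hM hx hae
    -- Points are measurable here as level sets of a continuous function, so no separation property
    -- of the space is used.
    have hset : ({x} : Set G.Space) = f ⁻¹' {M} := by ext z; simp [hx]
    have hm : MeasurableSet ({x} : Set G.Space) := by
      rw [hset]; exact hf.measurable (measurableSet_singleton M)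
    have hMM : M ≠ -M := fun h => hM (by linarith)
    -- Almost everywhere f = 2M·1_{x} − M; mean zero then fixes the mass of x.
    have e : ∫ z, f z ∂μ =
        ∫ z, (2 * M * ({x} : Set G.Space).indicator (fun _ => (1 : ℝ)) z - M) ∂μ := by
      refine integral_congr_ae ?_
      filter_upwards [hae] with z hz
      rcases hz with hz | hz
      · have := (hx z).1 hz
        rw [Set.indicator_of_mem (by simpa using this), hz]; ring
      · have : z ≠ x := fun h => hMM (((hx z).2 h).symm.trans hz)
        rw [Set.indicator_of_notMem (by simpa using this), hz]; ring
    rw [h0, integral_sub (((integrable_const _).indicator hm).const_mul _) (integrable_const _),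
      integral_const_mul, integral_indicator hm] at e
    simp only [integral_const, smul_eq_mul, mul_one, measureReal_restrict_apply_univ,
      probReal_univ, one_mul] at e
    have : μ.real {x} = 2⁻¹ := by
      have : M * (2 * μ.real {x} - 1) = 0 := by linarith
      have := (mul_eq_zero.1 this).resolve_left hM
      linarith
    rw [← ENNReal.toReal_eq_toReal_iff' (measure_ne_top _ _) (by simp)]
    simpa [Measure.real] using this
  have hμx := key M x y hM hx hae
  have hμy := key (-M) y x (neg_ne_zero.2 hM) hy (by simpa [or_comm] using hae)
  have hxy : x ≠ y := by
    rintro rfl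
    have h1 := (hx x).2 rfl
    have h2 := (hy x).2 rfl
    exact hM (by linarith)
  have hmy : MeasurableSet ({y} : Set G.Space) := by
    have : ({y} : Set G.Space) = f ⁻¹' {-M} := by ext z; simp [hy]
    rw [this]; exact hf.measurable (measurableSet_singleton _)
  have hnull : μ ({x, y} : Set G.Space)ᶜ = 0 := by
    refine measure_mono_null (fun z hz => ?_) (ae_iff.1 hae)
    simpa [hx, hy] using hz
  ext S hS
  have h1 : μ S = μ (S ∩ {x}) + μ (S ∩ {y}) := by
    rw [← measure_union _ (hS.inter hmy), ← Set.inter_union_distrib_left]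
    · refine (measure_inter_conull' ?_).symm
      exact measure_mono_null (fun z hz => hz.2) hnull
    · rw [Set.disjoint_left]
      rintro z ⟨_, rfl⟩ ⟨_, h⟩
      exact hxy h
  rw [h1, twoPointMeasure]
  simp only [Measure.coe_add, Measure.coe_smul, Pi.add_apply, Pi.smul_apply, smul_eq_mul,
    Measure.dirac_apply' _ hS]
  have h2 : ∀ z, μ {z} = 2⁻¹ → μ (S ∩ {z}) = 2⁻¹ * S.indicator 1 z := by
    intro z hz
    by_cases h : z ∈ S
    · rw [Set.inter_eq_right.2 (by simpa using h), hz, Set.indicator_of_mem h]; simp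
    · rw [Set.inter_singleton_eq_empty.2 h, Set.indicator_of_notMem h]; simp
  rw [h2 x hμx, h2 y hμy]

/-! ### Lower bound for positive eigenvalues and attainment -/

section

variable [Fintype V] {μ : Measure G.Space} [IsProbabilityMeasure μ] {t : ℝ} {f : G.Space → ℝ}

/-- Positive eigenvalues of `H_μ` are bounded below in terms of the maximal resistance, and
equality occurs for two-point measures only. -/
lemma IsEigenfunction.four_div_le (h : IsEigenfunction μ t f) (ht : 0 < t) {r : ℝ}
    (hr : ∀ x y : G.Space, resistance x y ≤ r) :
    4 / r ≤ t ∧ (t = 4 / r → ∃ x y : G.Space, x ≠ y ∧ μ = G.twoPointMeasure x y) := by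
  have hf := h.1.1
  have := G.compactSpace
  obtain ⟨x₀, -⟩ := G.exists_ne_points
  obtain ⟨x, -, hx⟩ := isCompact_univ.exists_isMaxOn ⟨x₀, trivial⟩ hf.1.continuousOn
  obtain ⟨y, -, hy⟩ := isCompact_univ.exists_isMinOn ⟨x₀, trivial⟩ hf.1.continuousOn
  replace hx : ∀ z, f z ≤ f x := fun z => hx (Set.mem_univ z)
  replace hy : ∀ z, f y ≤ f z := fun z => hy (Set.mem_univ z)
  set M := f x with hM
  set m := f y with hm
  set S := ∫ z, f z * f z ∂μ with hS
  have hS0 : 0 < S := h.2.2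
  have hmean := h.integral_eq_zero ht.ne'
  have hq := h.energy_self
  have i1 : Integrable f μ := integrable_of_continuous hf.1 μ
  have i2 : Integrable (fun z => f z * f z) μ := integrable_of_continuous (hf.1.mul hf.1) μ
  have hnn : 0 ≤ fun z => (M - f z) * (f z - m) := fun z =>
    mul_nonneg (sub_nonneg.2 (hx z)) (sub_nonneg.2 (hy z))
  have hI : ∫ z, (M - f z) * (f z - m) ∂μ = -S - M * m := by
    have e : ∀ z, (M - f z) * (f z - m) = (M + m) * f z - f z * f z - M * m := fun z => by ring
    have i3 : Integrable (fun z => (M + m) * f z - f z * f z) μ := (i1.const_mul _).sub i2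
    simp only [e]
    rw [integral_sub i3 (integrable_const _), integral_sub (i1.const_mul _) i2,
      integral_const_mul, hmean]
    simp [hS]
  have hI0 : 0 ≤ -S - M * m := hI ▸ integral_nonneg hnn
  have hle := sq_sub_le_energy_mul_resistance hf x y
  have hle' : G.energy f f * resistance x y ≤ G.energy f f * r :=
    mul_le_mul_of_nonneg_left (hr x y) (energy_self_nonneg f)
  have hq0 : 0 < G.energy f f := hq ▸ mul_pos ht hS0
  have hne : M ≠ m := by
    intro h
    rw [h] at hI0
    nlinarith [mul_self_nonneg m]
  have hr0 : 0 < r := lt_of_lt_of_le (resistance_pos fun h => hne (congrArg f h)) (hr x y)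
  -- Uses (M − m)² = (M + m)² − 4Mm; equality later forces m = −M.
  have h4 : 4 * S ≤ (M - m) ^ 2 := by nlinarith [sq_nonneg (M + m)]
  have h5 : 4 * S ≤ t * r * S := by
    calc _ ≤ _ := h4.trans (hle.trans hle')
      _ = _ := by rw [hq]; ring
  refine ⟨(div_le_iff₀ hr0).2 (le_of_mul_le_mul_right h5 hS0), fun htr => ?_⟩
  have hqr : G.energy f f * r = 4 * S := by rw [hq, htr, ← hS]; field_simp
  have heq : (M - m) ^ 2 = G.energy f f * r :=
    le_antisymm (hle.trans hle') (hqr ▸ h4)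
  have hmM : m = -M := by
    have : (M + m) ^ 2 ≤ 0 := by nlinarith
    have := pow_eq_zero_iff two_ne_zero |>.1 (le_antisymm this (sq_nonneg _))
    linarith
  have hz : -S - M * m = 0 := by rw [hmM] at heq ⊢; nlinarith
  have hcont : Continuous fun z => (M - f z) * (f z - m) :=
    (continuous_const.sub hf.1).mul (hf.1.sub continuous_const)
  have hae := (integral_eq_zero_iff_of_nonneg hnn
    (integrable_of_continuous hcont μ)).1 (hI.trans hz)
  refine ⟨x, y, fun h => hne (congrArg f h), eq_twoPointMeasure hf.1 (M := M)
    (fun h => hne (by rw [hmM, h, neg_zero])) (fun z => ⟨fun h => ?_, fun h => by rw [h]⟩)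
    (fun z => ⟨fun h => ?_, fun h => by rw [h, ← hmM]⟩) ?_ hmean⟩
  · exact eq_of_sq_sub_eq_energy hf hr hq0 hne heq h
  · exact eq_of_sq_sub_eq_energy hf hr hq0 hne.symm (by rw [← heq]; ring) (h.trans hmM.symm)
  · filter_upwards [hae] with z hz
    rcases mul_eq_zero.1 hz with h | h
    · exact Or.inl (sub_eq_zero.1 h).symm
    · exact Or.inr ((sub_eq_zero.1 h).trans hmM)

variable (G) in
/-- Functions of finite energy are controlled by their values on a finite set. -/
lemma exists_finite_net {δ : ℝ} (hδ : 0 < δ) : ∃ P : Finset G.Space, ∀ x, ∃ p ∈ P,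
    ∀ f ∈ G.H1, (f x - f p) ^ 2 ≤ δ * G.energy f f := by
  have := G.compactSpace
  obtain ⟨P, -, hP⟩ := isCompact_univ.elim_nhds_subcover
    (fun p : G.Space => {x | √(resistance x p) < √δ}) (fun p _ => by
      refine (isOpen_lt (continuous_sqrt_resistance_left p) continuous_const).mem_nhds ?_
      simpa [resistance_self] using hδ)
  refine ⟨P, fun x => ?_⟩
  obtain ⟨p, hp, hxp⟩ := Set.mem_iUnion₂.1 (hP (Set.mem_univ x))
  refine ⟨p, hp, fun f hf => (sq_sub_le_energy_mul_resistance hf x p).trans ?_⟩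
  rw [mul_comm]
  exact mul_le_mul_of_nonneg_right ((Real.sqrt_lt_sqrt_iff (resistance_nonneg _ _)).1 hxp).le
    (energy_self_nonneg f)

variable (μ) in
/-- The positive eigenvalues of `H_μ` do not accumulate. -/
lemma finite_eigenvalues (Λ : ℝ) :
    {t : ℝ | 0 < t ∧ t ≤ Λ ∧ ∃ f, IsEigenfunction μ t f}.Finite := by
  by_contra hinf
  have hΛ : 0 < |Λ| + 1 := by positivity
  -- With this δ, a function vanishing on P satisfies (|Λ| + 1)∫f² dμ ≤ q(f), which contradicts q(f)
  -- ≤ |Λ|∫f² dμ for a nonzero combination of eigenfunctions with eigenvalues at most Λ.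
  obtain ⟨P, hP⟩ := G.exists_finite_net (δ := 1 / (|Λ| + 1)) (by positivity)
  -- One more eigenvalue than net points, so some nontrivial combination of eigenfunctions vanishes
  -- on P. Distinct eigenvalues make them orthogonal.
  obtain ⟨T, hT, hcard⟩ := Set.Infinite.exists_subset_card_eq hinf (P.card + 1)
  choose F hF using fun t : T => (hT t.2).2.2
  let A : (T → ℝ) →ₗ[ℝ] (P → ℝ) :=
    Fintype.linearCombination ℝ (fun (t : T) (p : P) => F t p)
  have hker : LinearMap.ker A ≠ ⊥ := LinearMap.ker_ne_bot_of_finrank_lt (by simp [hcard])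
  obtain ⟨a, haA, ha⟩ := (Submodule.ne_bot_iff _).1 hker
  let H : T → G.H1Submodule := fun t => ⟨F t, (hF t).1.1⟩
  let f : G.H1Submodule := ∑ t, a t • H t
  have hfx : ∀ x, f.1 x = ∑ t, a t * F t x := fun x => by
    simp [f, H, Finset.sum_apply]
  have hfP : ∀ p ∈ P, f.1 p = 0 := fun p hp => by
    have := congrFun (LinearMap.mem_ker.1 haA) ⟨p, hp⟩
    simpa [A, Fintype.linearCombination_apply, hfx, Finset.sum_apply] using this
  have horth : ∀ s t : T, s ≠ t → ∫ x, F s x * F t x ∂μ = 0 := fun s t hst =>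
    (hF s).integral_mul_eq_zero (hF t) fun h => hst (Subtype.ext h)
  set n : T → ℝ := fun t => ∫ x, F t x * F t x ∂μ with hn
  have hnpos : ∀ t, 0 < n t := fun t => (hF t).2.2
  have hE : G.energy f.1 f.1 = ∑ t, a t ^ 2 * (t.1 * n t) := by
    rw [← energyForm_apply]
    simp only [f, map_sum, map_smul, LinearMap.sum_apply, LinearMap.smul_apply, smul_eq_mul]
    refine Finset.sum_congr rfl fun t _ => ?_
    rw [Finset.sum_eq_single t]
    · rw [energyForm_apply, (hF t).energy_self]; ring
    · intro s _ hst
      rw [energyForm_apply, (hF s).2.1 _ (hF t).1, horth s t hst]; ring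
    · simp
  have hint : ∀ s t, Integrable (fun x => F s x * F t x) μ := fun s t =>
    integrable_of_continuous ((hF s).1.1.1.mul (hF t).1.1.1) μ
  have hL : ∫ x, f.1 x * f.1 x ∂μ = ∑ t, a t ^ 2 * n t := by
    have e : ∀ x, f.1 x * f.1 x = ∑ s, ∑ t, a s * a t * (F s x * F t x) := fun x => by
      rw [hfx, Finset.sum_mul_sum]
      exact Finset.sum_congr rfl fun s _ => Finset.sum_congr rfl fun t _ => by ring
    simp only [e]
    rw [integral_finsetSum _ fun s _ => integrable_finsetSum _ fun t _ => (hint s t).const_mul _]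
    refine Finset.sum_congr rfl fun s _ => ?_
    rw [integral_finsetSum _ fun t _ => (hint s t).const_mul _, Finset.sum_eq_single s]
    · rw [integral_const_mul, hn]; ring
    · intro t _ hst
      rw [integral_const_mul, horth s t hst.symm, mul_zero]
    · simp
  have hLpos : 0 < ∑ t, a t ^ 2 * n t := by
    obtain ⟨t, ht⟩ := Function.ne_iff.1 ha
    exact Finset.sum_pos' (fun t _ => mul_nonneg (sq_nonneg _) (hnpos t).le)
      ⟨t, Finset.mem_univ t, mul_pos (sq_pos_of_ne_zero ht) (hnpos t)⟩
  have hEL : G.energy f.1 f.1 ≤ |Λ| * ∑ t, a t ^ 2 * n t := by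
    rw [hE, Finset.mul_sum]
    refine Finset.sum_le_sum fun t _ => ?_
    have : t.1 ≤ |Λ| := (hT t.2).2.1.trans (le_abs_self Λ)
    nlinarith [mul_nonneg (sq_nonneg (a t)) (hnpos t).le]
  have hpt : ∀ x, f.1 x * f.1 x ≤ 1 / (|Λ| + 1) * G.energy f.1 f.1 := fun x => by
    obtain ⟨p, hp, h⟩ := hP x
    have := h f.1 f.2
    rwa [hfP p hp, sub_zero, sq] at this
  have hfin : ∫ x, f.1 x * f.1 x ∂μ ≤ 1 / (|Λ| + 1) * G.energy f.1 f.1 := by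
    refine (integral_mono (integrable_of_continuous (f.2.1.mul f.2.1) μ) (integrable_const _)
      hpt).trans ?_
    simp
  rw [hL, div_mul_eq_mul_div, one_mul, le_div_iff₀ hΛ] at hfin
  nlinarith

/-- The first nontrivial eigenvalue is attained. -/
lemma exists_isEigenfunction_of_eigenvalue_le {Λ : ℝ} (h : G.eigenvalue μ 1 ≤ (Λ : EReal)) :
    ∃ t f, 0 < t ∧ t ≤ Λ ∧ IsEigenfunction μ t f := by
  by_contra hcon
  push Not at hcon
  have hS := finite_eigenvalues μ (Λ + 1)
  -- Inserting Λ + 1 keeps the finite set nonempty and bounds the eigenvalues beyond it. The minimum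
  -- `a` is then a lower bound for all positive eigenvalues that exceeds Λ.
  obtain ⟨a, ha, hmin⟩ := Set.exists_min_image _ id (hS.insert (Λ + 1)) ⟨_, Set.mem_insert _ _⟩
  have haΛ : Λ < a := by
    rcases ha with rfl | ⟨h1, h2, f, hf⟩
    · linarith
    · exact not_le.1 fun hle => hcon a f h1 hle hf
  refine absurd (le_trans ?_ h) (not_le.2 (EReal.coe_lt_coe_iff.2 haΛ))
  refine le_sInf ?_
  rintro Λ' ⟨u, t, hu, hut⟩
  obtain ⟨i, f, hi, hf⟩ := exists_pos_isEigenfunction hu fun i => (hut i).1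
  refine le_trans (EReal.coe_le_coe_iff.2 ?_) (hut i).2
  rcases le_or_gt (t i) (Λ + 1) with hle | hgt
  · exact hmin _ (Or.inr ⟨hi, hle, f, hf⟩)
  · exact (hmin _ (Or.inl rfl)).trans hgt.le

/-- The first nontrivial eigenvalue is bounded below in terms of the maximal resistance. -/
lemma four_div_le_eigenvalue (μ : Measure G.Space) [IsProbabilityMeasure μ] {r : ℝ}
    (hr : ∀ x y : G.Space, resistance x y ≤ r) : ((4 / r : ℝ) : EReal) ≤ G.eigenvalue μ 1 := by
  refine le_sInf ?_
  rintro Λ ⟨u, t, hu, hut⟩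
  obtain ⟨i, f, hi, hf⟩ := exists_pos_isEigenfunction hu fun i => (hut i).1
  exact le_trans (EReal.coe_le_coe_iff.2 (hf.four_div_le hi hr).1) (hut i).2

end

end

/-! ### Two-point measures and the upper bound -/

section

section

variable {V E : Type*} {G : MetricGraph V E}

instance (x y : G.Space) : IsProbabilityMeasure (G.twoPointMeasure x y) :=
  ⟨by simp [twoPointMeasure, ENNReal.inv_two_add_inv_two]⟩

lemma of_ae_twoPointMeasure {x y : G.Space} {p : G.Space → Prop}
    (h : ∀ᵐ z ∂G.twoPointMeasure x y, p z) : p x ∧ p y := by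
  rw [ae_iff, twoPointMeasure] at h
  simp only [Measure.coe_add, Measure.coe_smul, Pi.add_apply, Pi.smul_apply, smul_eq_mul,
    add_eq_zero, mul_eq_zero, ENNReal.inv_eq_zero, ENNReal.ofNat_ne_top, false_or] at h
  constructor
  · by_contra hx
    have := Measure.dirac_apply_of_mem (a := x) (s := {z | ¬p z}) hx
    rw [h.1] at this
    exact zero_ne_one this
  · by_contra hy
    have := Measure.dirac_apply_of_mem (a := y) (s := {z | ¬p z}) hy
    rw [h.2] at this
    exact zero_ne_one this

lemma integral_twoPointMeasure {h : G.Space → ℝ} (hh : Continuous h) (x y : G.Space) :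
    ∫ z, h z ∂G.twoPointMeasure x y = (h x + h y) / 2 := by
  have hs : StronglyMeasurable h := hh.stronglyMeasurable
  have hi : ∀ x : G.Space, Integrable h (Measure.dirac x) := fun x =>
    ⟨hs.aestronglyMeasurable, by
      rw [HasFiniteIntegral, lintegral_dirac' _ hs.enorm]; exact enorm_lt_top⟩
  rw [twoPointMeasure, integral_add_measure ((hi x).smul_measure (by simp))
    ((hi y).smul_measure (by simp)), integral_smul_measure, integral_smul_measure,
    integral_dirac' _ _ hs, integral_dirac' _ _ hs]
  simp only [ENNReal.toReal_inv, ENNReal.toReal_ofNat, smul_eq_mul]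
  ring

/-- This inclusion suffices to place f_{x,y} in the form domain: a test function vanishing on the
support then vanishes at both points. -/
lemma pair_subset_support_twoPointMeasure (x y : G.Space) :
    {x, y} ⊆ (G.twoPointMeasure x y).support := by
  rintro z hz
  rw [Measure.mem_support_iff_forall]
  intro U hU
  have hzU := mem_of_mem_nhds hU
  refine pos_iff_ne_zero.2 fun h0 => ?_
  have := of_ae_twoPointMeasure (p := fun z => z ∉ U) (x := x) (y := y)
    (by rw [ae_iff]; simpa using h0)
  rcases hz with rfl | rfl
  exacts [this.1 hzU, this.2 hzU]

end

variable {V E : Type*} [Fintype V] [Fintype E] [Nonempty E] {G : MetricGraph V E}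

/-- The constant one and f_{x,y} are independent eigenfunctions with eigenvalues 0 and 4/R. The
factor 4/R arises because q(f,φ) = (2/R)(φ(x) − φ(y)), while ∫fφ dμ is half that difference. -/
lemma eigenvalue_twoPointMeasure_le {x y : G.Space} (hxy : x ≠ y) :
    G.eigenvalue (G.twoPointMeasure x y) 1 ≤ ((4 / resistance x y : ℝ) : EReal) := by
  obtain ⟨f, ⟨hfx, hfy, hfH, hharm⟩, -, hE⟩ := exists_isTwoPointSolution hxy
  set μ := G.twoPointMeasure x y with hμ
  have hR := resistance_pos hxy
  have hfμ : f ∈ G.H1μ μ := by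
    refine ⟨hfH, fun g hg h0 => hharm g hg fun z hz => h0 z ?_⟩
    rw [Set.mem_compl_iff, not_not] at hz ⊢
    exact pair_subset_support_twoPointMeasure x y hz
  have L : ∀ h : G.Space → ℝ, Continuous h → MemLp h 2 μ := fun h hh => memLp_of_continuous hh μ 2
  have c1 : Continuous fun _ : G.Space => (1 : ℝ) := continuous_const
  have maps : ∀ (h : G.Space → ℝ) (hh : h ∈ G.H1μ μ) (t : ℝ),
      (∀ φ ∈ G.H1μ μ, G.energy h φ = t * ((h x * φ x + h y * φ y) / 2)) →
      G.LaplacianMaps μ ((L h hh.1.1).toLp h) (t • (L h hh.1.1).toLp h) := by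
    intro h hh t ht
    refine ⟨h, hh, MemLp.coeFn_toLp _, fun φ hφ => ?_⟩
    rw [ht φ hφ, ← integral_twoPointMeasure (h := fun z => h z * φ z) (hh.1.1.mul hφ.1.1),
      ← integral_const_mul]
    refine integral_congr_ae ?_
    filter_upwards [Lp.coeFn_smul t ((L h hh.1.1).toLp h), MemLp.coeFn_toLp (L h hh.1.1)]
      with z h1 h2
    rw [h1, Pi.smul_apply, h2, smul_eq_mul, mul_assoc]
  refine sInf_le ⟨![(L _ c1).toLp _, (L f hfH.1).toLp f], ![0, 4 / resistance x y], ?_, ?_⟩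
  · rw [LinearIndependent.pair_iff]
    intro a b hab
    have hae : ∀ᵐ z ∂μ, a * 1 + b * f z = 0 := by
      filter_upwards [Lp.coeFn_add (a • (L _ c1).toLp _) (b • (L f hfH.1).toLp f),
        Lp.coeFn_smul a ((L _ c1).toLp _), Lp.coeFn_smul b ((L f hfH.1).toLp f),
        MemLp.coeFn_toLp (L _ c1), MemLp.coeFn_toLp (L f hfH.1), Lp.coeFn_zero ℝ 2 μ]
        with z h1 h2 h3 h4 h5 h6
      rw [hab, h6, Pi.add_apply, h2, h3, Pi.smul_apply, Pi.smul_apply, h4, h5] at h1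
      exact h1.symm
    obtain ⟨hx, hy⟩ := of_ae_twoPointMeasure hae
    rw [hfx] at hx
    rw [hfy] at hy
    constructor <;> linarith
  · intro i
    fin_cases i
    · refine ⟨maps _ (const_mem_H1μ 1 μ) 0 fun φ _ => ?_, ?_⟩
      · rw [energy_const_left, zero_mul]
      · exact EReal.coe_le_coe_iff.2 (by simpa using div_nonneg zero_le_four hR.le)
    · refine ⟨maps f hfμ _ fun φ hφ => ?_, le_rfl⟩
      simp only [Fin.mk_one, Matrix.cons_val_one, Matrix.cons_val_zero]
      rw [hE φ hφ.1, hfx, hfy]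
      ring

end

end MetricGraph

end

/-! ### The main theorem, with optimal value 4/r -/

theorem mainTheorem4 {V E : Type*} [Fintype V] [Fintype E] [Nonempty E] (G : MetricGraph V E) :
    -- the minimum over probability measures is attained at a two-point measure
    (∃ x y : G.Space, x ≠ y ∧
      G.optimalEigenvalue 1 = G.eigenvalue (G.twoPointMeasure x y) 1) ∧
    -- every minimizing probability measure is of this form
    (∀ μ : MeasureTheory.Measure G.Space, MeasureTheory.IsProbabilityMeasure μ →
      G.optimalEigenvalue 1 = G.eigenvalue μ 1 →
      ∃ x y : G.Space, x ≠ y ∧ μ = G.twoPointMeasure x y) ∧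
    -- the optimal eigenvalue is the minimum of the first eigenvalues of two-point measures
    IsLeast {a : EReal | ∃ x y : G.Space, x ≠ y ∧ a = G.eigenvalue (G.twoPointMeasure x y) 1}
      (G.optimalEigenvalue 1) ∧
    -- `f_{x,y}` is well defined, and the optimal eigenvalue is its minimal energy
    (∀ x y : G.Space, x ≠ y → ∃! f : G.Space → ℝ, G.IsTwoPointSolution x y f) ∧
    IsLeast {a : EReal | ∃ (x y : G.Space) (f : G.Space → ℝ), x ≠ y ∧
        G.IsTwoPointSolution x y f ∧ a = ((G.energy f f : ℝ) : EReal)}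
      (G.optimalEigenvalue 1) := by
  obtain ⟨x₀, y₀, hne, hmax⟩ := G.exists_max_resistance
  set r := MetricGraph.resistance x₀ y₀ with hr
  have hr0 : 0 < r := MetricGraph.resistance_pos hne
  have hlow : ((4 / r : ℝ) : EReal) ≤ G.optimalEigenvalue 1 :=
    le_iInf₂ fun μ _ => MetricGraph.four_div_le_eigenvalue μ hmax
  have hopt : ∀ x y : G.Space,
      G.optimalEigenvalue 1 ≤ G.eigenvalue (G.twoPointMeasure x y) 1 :=
    fun x y => iInf₂_le (f := fun μ (_ : MeasureTheory.IsProbabilityMeasure μ) => G.eigenvalue μ 1)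
      (G.twoPointMeasure x y) inferInstance
  have hup := MetricGraph.eigenvalue_twoPointMeasure_le hne
  have hval : G.optimalEigenvalue 1 = ((4 / r : ℝ) : EReal) :=
    le_antisymm ((hopt x₀ y₀).trans hup) hlow
  have hatt : G.optimalEigenvalue 1 = G.eigenvalue (G.twoPointMeasure x₀ y₀) 1 :=
    le_antisymm (hopt x₀ y₀) (hup.trans hlow)
  refine ⟨⟨x₀, y₀, hne, hatt⟩, fun μ hμ h => ?_, ⟨⟨x₀, y₀, hne, hatt⟩, ?_⟩, fun x y hxy => ?_,
    ⟨?_, ?_⟩⟩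
  -- A minimiser has an actual eigenfunction with 0 < t ≤ 4/r, so the lower bound is an equality and
  -- rigidity applies.
  · obtain ⟨t, f, ht, htr, hf⟩ :=
      MetricGraph.exists_isEigenfunction_of_eigenvalue_le (h.symm.trans hval).le
    obtain ⟨h1, h2⟩ := hf.four_div_le ht hmax
    exact h2 (le_antisymm htr h1)
  · rintro _ ⟨x, y, _, rfl⟩
    exact hopt x y
  · obtain ⟨f, hf, -⟩ := MetricGraph.exists_isTwoPointSolution hxy
    exact ⟨f, hf, fun f' hf' => hf'.eq hf⟩
  · obtain ⟨f, hf, hE, -⟩ := MetricGraph.exists_isTwoPointSolution hne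
    exact ⟨x₀, y₀, f, hne, hf, by rw [hval, hE]⟩
  -- By uniqueness the energy is 4/R(x,y), which is smallest where the resistance is largest.
  · rintro _ ⟨x, y, f, hxy, hf, rfl⟩
    obtain ⟨f', hf', hE, -⟩ := MetricGraph.exists_isTwoPointSolution hxy
    rw [hf.eq hf', hE, hval, EReal.coe_le_coe_iff]
    exact div_le_div_of_nonneg_left (by norm_num) (MetricGraph.resistance_pos hxy) (hmax x y)
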